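/- Let $M$ be a smooth supermanifold with structure sheaf $\mathcal O$, $C^\infty(M)=\mathcal O(M)$, and write $\widetilde f\in\mathbb Z_2$ for the Grassmann parity of a homogeneous $f$. In the natural local coordinates $(x^A,p_A)$ of $T^*M$, where $\widetilde{p}_A=\widetilde{x}^A=\widetilde A$ and $\overline p_A=\frac{\partial x^B}{\partial\overline x^A}p_B$ under a change of coordinates on $M$, the canonical Poisson bracket on $C^\infty(T^*M)$ is $$\{F,G\}=(-1)^{\widetilde A\widetilde F+\widetilde A}\frac{\partial F}{\partial p_A}\frac{\partial G}{\partial x^A}-(-1)^{\widetilde A\widetilde F}\frac{\partial F}{\partial x^A}\frac{\partial G}{\partial p_A}.$$ An odd Jacobi structure $(S,Q)$ on $M$ consists of an odd function $S\in C^\infty(T^*M)$, homogeneous of degree two in the fibre coordinates (locally $S=\frac12 S^{AB}(x)p_Bp_A$), and an odd vector field $Q$ on $M$ (locally $Q=Q^A(x)\frac{\partial}{\partial x^A}$, with principal symbol $\mathcal Q=Q^A(x)p_A$), such that $$Q^2=0,\qquad L_QS=\{\mathcal Q,S\}=0,\qquad \{S,S\}=-2\,\mathcal Q S .$$ Theorem.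 Let $(S,Q)$ be an odd Jacobi structure on $M$. There is a unique $\mathbb R$-bilinear operation $[\![\cdot,\cdot]\!]_J$ on $C^\infty(M)$, the odd Jacobi bracket, such that $$[\![f,g]\!]_J=(-1)^{\widetilde f+1}\{\{S,f\},g\}-(-1)^{\widetilde f+1}\{\mathcal Q,fg\}$$ for all homogeneous $f,g\in C^\infty(M)$ (functions on $M$ being regarded as functions on $T^*M$ by pull-back). It makes $C^\infty(M)$ an odd Jacobi algebra; that is, for all homogeneous $f,g,h\in C^\infty(M)$: 0. (Grading) $[\![f,g]\!]_J$ is homogeneous of parity $\widetilde f+\widetilde g+1$. 1. (Symmetry) $[\![f,g]\!]_J=-(-1)^{(\widetilde f+1)(\widetilde g+1)}[\![g,f]\!]_J$. 2. (Jacobi identity) $\displaystyle\sum_{\mathrm{cyclic}(f,g,h)}(-1)^{(\widetilde f+1)(\widetilde h+1)}[\![f,[\![g,h]\!]_J]\!]_J=0$. 3. (Generalised Leibniz rule) $[\![f,gh]\!]_J=[\![f,g]\!]_J\,h+(-1)^{(\widetilde f+1)\widetilde g}\,g\,[\![f,h]\!]_J-[\![f,\mathbb 1]\!]_J\,gh$.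 -/

import Mathlib

open CategoryTheory Opposite TopologicalSpace
open scoped TensorProduct ContDiff

universe u

noncomputable section

/-! ## Superdomains -/

section Superdomain

set_option linter.unusedSectionVars false

variable {I J : Type} [Fintype I]

/-- Extension by zero of a function on an open subset of `ℝ^I` (only its values on the open set
are ever used). -/
def extendZero {V : Opens (I → ℝ)} (f : V → ℝ) : (I → ℝ) → ℝ :=
  Function.extend (Subtype.val : V → (I → ℝ)) f 0

theorem extendZero_coe {V : Opens (I → ℝ)} (f : V → ℝ) (x : V) : extendZero f x = f x :=
  Subtype.val_injective.extend_apply f 0 x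

theorem extendZero_contDiffOn {V : Opens (I → ℝ)} {f : V → ℝ} {F : (I → ℝ) → ℝ}
    (hF : ContDiffOn ℝ ∞ F V) (h : ∀ x : V, f x = F x) :
    ContDiffOn ℝ ∞ (extendZero f) V :=
  hF.congr fun x hx => (extendZero_coe f ⟨x, hx⟩).trans (h ⟨x, hx⟩)

/-- The algebra `C^∞(V)` of smooth real functions on an open set `V ⊆ ℝ^I`. -/
def SmoothFun (V : Opens (I → ℝ)) : Subalgebra ℝ (V → ℝ) where
  carrier := {f | ContDiffOn ℝ ∞ (extendZero f) V}
  mul_mem' {f g} hf hg := extendZero_contDiffOn (ContDiffOn.mul hf hg) fun x => by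
    simp [extendZero_coe]
  add_mem' {f g} hf hg := extendZero_contDiffOn (ContDiffOn.add hf hg) fun x => by
    simp [extendZero_coe]
  algebraMap_mem' r := extendZero_contDiffOn (contDiffOn_const (c := r)) fun x => rfl

/-- A function that is smooth on all of `ℝ^I`, as a smooth function on `V`. -/
def SmoothFun.mk {V : Opens (I → ℝ)} (F : (I → ℝ) → ℝ) (hF : ContDiff ℝ ∞ F) : SmoothFun V :=
  ⟨fun x => F x, extendZero_contDiffOn hF.contDiffOn fun _ => rfl⟩

/-- Pull-back of smooth functions along a smooth map `φ : ℝ^I → ℝ^{I'}` with `φ(V) ⊆ V'`. -/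
def SmoothFun.comap {I' : Type} [Fintype I'] {V : Opens (I → ℝ)} {V' : Opens (I' → ℝ)}
    (φ : (I → ℝ) → (I' → ℝ)) (hφ : ContDiff ℝ ∞ φ) (h : ∀ x ∈ V, φ x ∈ V') :
    SmoothFun V' →ₐ[ℝ] SmoothFun V where
  toFun f := ⟨fun x => f.1 ⟨φ x, h x x.2⟩,
    extendZero_contDiffOn (F := extendZero f.1 ∘ φ)
      (ContDiffOn.comp (t := (V' : Set (I' → ℝ))) f.2 hφ.contDiffOn h) fun x =>
        (extendZero_coe f.1 ⟨φ x, h x x.2⟩).symm⟩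
  map_one' := rfl
  map_mul' _ _ := rfl
  map_zero' := rfl
  map_add' _ _ := rfl
  commutes' _ := rfl

theorem SmoothFun.differentiableAt {V : Opens (I → ℝ)} (f : SmoothFun V) (x : V) :
    DifferentiableAt ℝ (extendZero f.1) x :=
  (ContDiffOn.contDiffAt f.2 (V.isOpen.mem_nhds x.2)).differentiableAt (by simp)

theorem SmoothFun.eventuallyEq {V : Opens (I → ℝ)} {f : V → ℝ} {F : (I → ℝ) → ℝ}
    (h : ∀ x : V, f x = F x) (x : V) : extendZero f =ᶠ[nhds (x : I → ℝ)] F :=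
  Filter.eventuallyEq_of_mem (V.isOpen.mem_nhds x.2) fun y hy =>
    (extendZero_coe f ⟨y, hy⟩).trans (h ⟨y, hy⟩)

open Classical in
/-- The partial derivative `∂/∂x^i` on `C^∞(V)`. -/
def SmoothFun.pderiv {V : Opens (I → ℝ)} (i : I) : SmoothFun V →ₗ[ℝ] SmoothFun V where
  toFun f := ⟨fun x => fderiv ℝ (extendZero f.1) x (Pi.single i 1),
    extendZero_contDiffOn
      (F := fun x => fderiv ℝ (extendZero f.1) x (Pi.single i 1))
      ((ContDiffOn.fderiv_of_isOpen (m := ∞) f.2 V.isOpen (by simp)).clm_apply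
        contDiffOn_const) fun _ => rfl⟩
  map_add' f g := by
    ext x
    have h : extendZero (f + g).1 =ᶠ[nhds (x : I → ℝ)] extendZero f.1 + extendZero g.1 :=
      SmoothFun.eventuallyEq (fun y => by simp [extendZero_coe]) x
    change fderiv ℝ (extendZero (f + g).1) x _ = _
    rw [h.fderiv_eq, fderiv_add (SmoothFun.differentiableAt f x) (SmoothFun.differentiableAt g x)]
    rfl
  map_smul' c f := by
    ext x
    have h : extendZero (c • f).1 =ᶠ[nhds (x : I → ℝ)] c • extendZero f.1 :=
      SmoothFun.eventuallyEq (fun y => by simp [extendZero_coe]) x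
    change fderiv ℝ (extendZero (c • f).1) x _ = _
    rw [h.fderiv_eq, fderiv_const_smul (SmoothFun.differentiableAt f x)]
    rfl

/-- The real Grassmann algebra `Λ(ξ^j : j ∈ J)`. -/
abbrev Grassmann (J : Type) : Type := ExteriorAlgebra ℝ (J →₀ ℝ)

/-- Superfunctions `C^∞(V) ⊗ Λ(ξ^j : j ∈ J)` on the superdomain with body `V ⊆ ℝ^I` and odd
coordinates indexed by `J`. -/
def SuperFun (J : Type) (V : Opens (I → ℝ)) : Type := SmoothFun V ⊗[ℝ] Grassmann J

instance (V : Opens (I → ℝ)) : Ring (SuperFun J V) :=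
  inferInstanceAs (Ring (SmoothFun V ⊗[ℝ] Grassmann J))

instance (V : Opens (I → ℝ)) : Algebra ℝ (SuperFun J V) :=
  inferInstanceAs (Algebra ℝ (SmoothFun V ⊗[ℝ] Grassmann J))

namespace SuperFun

variable {V : Opens (I → ℝ)}

/-- Restriction of superfunctions to a smaller superdomain. -/
def restrict {V' : Opens (I → ℝ)} (h : V' ≤ V) : SuperFun J V →ₐ[ℝ] SuperFun J V' :=
  Algebra.TensorProduct.map (SmoothFun.comap id contDiff_id h) (AlgHom.id ℝ _)

/-- The parity automorphism `f ↦ (-1)^{f̃} f`; it changes the sign of every odd coordinate. -/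
def invol : SuperFun J V →ₐ[ℝ] SuperFun J V :=
  Algebra.TensorProduct.map (AlgHom.id ℝ _) CliffordAlgebra.involute

/-- Superfunctions of Grassmann parity `k`. -/
def parity (k : ZMod 2) : Submodule ℝ (SuperFun J V) :=
  LinearMap.eqLocus (invol (J := J) (V := V)).toLinearMap ((-1 : ℝ) ^ k.val • LinearMap.id)

/-- The coordinates of the superdomain: `x^i` (even) for `inl i`, `ξ^j` (odd) for `inr j`. -/
def coord : I ⊕ J → SuperFun J V
  | .inl i => SmoothFun.mk (fun x => x i) (contDiff_apply ℝ ℝ i) ⊗ₜ 1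
  | .inr j => 1 ⊗ₜ ExteriorAlgebra.ι ℝ (Finsupp.single j 1)

/-- The (left) partial derivatives `∂/∂x^i` and `∂/∂ξ^j`. -/
def pderiv : I ⊕ J → SuperFun J V →ₗ[ℝ] SuperFun J V
  | .inl i => LinearMap.rTensor _ (SmoothFun.pderiv i)
  | .inr j => LinearMap.lTensor _ (CliffordAlgebra.contractLeft (Finsupp.lapply j))

end SuperFun

/-- The Grassmann parity `Ã` of a coordinate index `A`. -/
def indexParity : I ⊕ J → ZMod 2
  | .inl _ => 0
  | .inr _ => 1

/-! ## The cotangent bundle of a superdomain, in natural coordinates `(x^A, p_A)` -/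

/-- The body of the cotangent bundle: the points `(x, p)` with `x ∈ V`. -/
def cotangentOpen (V : Opens (I → ℝ)) : Opens (I ⊕ I → ℝ) where
  carrier := {y | (fun i => y (.inl i)) ∈ V}
  is_open' := V.isOpen.preimage (by fun_prop)

theorem cotangentOpen_mono {V' V : Opens (I → ℝ)} (h : V' ≤ V) :
    cotangentOpen V' ≤ cotangentOpen V := fun _ hy => h hy

/-- Smooth functions on the cotangent bundle of the superdomain over `V`: superfunctions of the
even variables `x^i, p_i` and the odd variables `ξ^j, π_j`. -/
abbrev CotFun (J : Type) (V : Opens (I → ℝ)) : Type := SuperFun (J ⊕ J) (cotangentOpen V)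

namespace CotFun

variable {V : Opens (I → ℝ)}

/-- The position variable `x^A`, as an index of a coordinate on the cotangent bundle. -/
def pos : I ⊕ J → (I ⊕ I) ⊕ (J ⊕ J) := Sum.map .inl .inl

/-- The conjugate momentum variable `p_A`, as an index of a coordinate on the cotangent bundle. -/
def mom : I ⊕ J → (I ⊕ I) ⊕ (J ⊕ J) := Sum.map .inr .inr

/-- The momentum coordinate `p_A`. -/
def momentum (A : I ⊕ J) : CotFun J V := SuperFun.coord (mom A)

/-- Pull-back of functions from the base to the cotangent bundle. -/
def pullback : SuperFun J V →ₐ[ℝ] CotFun J V :=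
  Algebra.TensorProduct.map
    (SmoothFun.comap (fun y i => y (.inl i)) (by fun_prop) fun _ hy => hy)
    (ExteriorAlgebra.map (Finsupp.lmapDomain ℝ ℝ Sum.inl))

/-- `F ↦ (-1)^{Ã F̃} F`. -/
def koszul (A : I ⊕ J) (F : CotFun J V) : CotFun J V :=
  if indexParity A = 0 then F else SuperFun.invol F

/-- The canonical Poisson bracket
`{F,G} = ∑_A (-1)^{Ã F̃ + Ã} ∂F/∂p_A ∂G/∂x^A - (-1)^{Ã F̃} ∂F/∂x^A ∂G/∂p_A`. -/
def poisson [Fintype J] (F G : CotFun J V) : CotFun J V :=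
  ∑ A : I ⊕ J,
    ((-1 : ℝ) ^ (indexParity A).val •
        (SuperFun.pderiv (mom A) (koszul A F) * SuperFun.pderiv (pos A) G)
      - SuperFun.pderiv (pos A) (koszul A F) * SuperFun.pderiv (mom A) G)

/-- Restriction to the cotangent bundle of a smaller superdomain. -/
def restrict {V' : Opens (I → ℝ)} (h : V' ≤ V) : CotFun J V →ₐ[ℝ] CotFun J V' :=
  SuperFun.restrict (cotangentOpen_mono h)

/-- `F = ½ ∑ S^{AB}(x) p_B p_A`: homogeneous of degree two in the fibre coordinates. -/
def IsQuadratic [Fintype J] (F : CotFun J V) : Prop :=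
  ∃ s : I ⊕ J → I ⊕ J → SuperFun J V,
    F = (1 / 2 : ℝ) • ∑ A, ∑ B, pullback (s A B) * momentum B * momentum A

/-- Let `τ : O(V') ≃ O(V)` express functions of the coordinates `x̄` on `V'` in terms of the
coordinates `x` on `V`. A parity preserving homomorphism `Φ` of function algebras is the induced
change of natural coordinates of the cotangent bundle if it extends `τ` and
`p̄_A = ∑_B (∂x^B/∂x̄^A) p_B`. -/
structure IsCotangentLift [Fintype J] {V' : Opens (I → ℝ)}
    (τ : SuperFun J V' ≃ₐ[ℝ] SuperFun J V) (Φ : CotFun J V' →ₐ[ℝ] CotFun J V) : Prop where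
  invol : ∀ F, Φ (SuperFun.invol F) = SuperFun.invol (Φ F)
  base : ∀ f, Φ (pullback f) = pullback (τ f)
  momentum : ∀ A, Φ (momentum A) =
    ∑ B, pullback (τ (SuperFun.pderiv A (τ.symm (SuperFun.coord B)))) * momentum B

end CotFun

end Superdomain

/-! ## Supermanifolds -/

/-- A topological space with a sheaf of supercommutative real superalgebras. -/
structure SuperSpace where
  /-- the underlying topological space -/
  space : TopCat.{u}
  /-- the structure sheaf -/
  sheaf : TopCat.Sheaf (AlgCat.{u} ℝ) space
  /-- the sections of given Grassmann parity -/
  parity : ∀ U : Opens space, ZMod 2 → Submodule ℝ (sheaf.presheaf.obj (op U))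
  graded : ∀ U, SetLike.GradedMonoid (parity U)
  internal : ∀ U, DirectSum.IsInternal (parity U)
  map_parity : ∀ {U V : Opens space} (h : U ≤ V) (k : ZMod 2), ∀ f ∈ parity V k,
    (sheaf.presheaf.map (homOfLE h).op).hom f ∈ parity U k
  supercomm : ∀ (U : Opens space) (i j : ZMod 2), ∀ f ∈ parity U i, ∀ g ∈ parity U j,
    f * g = (-1 : ℝ) ^ (i * j).val • (g * f)

namespace SuperSpace

/-- The algebra of sections of the structure sheaf over `U`. -/
abbrev sec (M : SuperSpace.{u}) (U : Opens M.space) : Type u := M.sheaf.presheaf.obj (op U)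

/-- The algebra `C^∞(M)` of global functions. -/
abbrev Fun (M : SuperSpace.{u}) : Type u := M.sec ⊤

/-- The restriction maps of the structure sheaf. -/
def res (M : SuperSpace.{u}) {U V : Opens M.space} (h : U ≤ V) : M.sec V →ₐ[ℝ] M.sec U :=
  (M.sheaf.presheaf.map (homOfLE h).op).hom

end SuperSpace

/-- The open subset of `ℝ^p` corresponding to (the part in the domain of `e` of) an open set `W`. -/
def chartImage {X : Type u} [TopologicalSpace X] {p : ℕ}
    (e : OpenPartialHomeomorph X (Fin p → ℝ)) (W : Opens X) : Opens (Fin p → ℝ) where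
  carrier := e.target ∩ e.symm ⁻¹' W
  is_open' := e.symm.isOpen_inter_preimage W.isOpen

theorem chartImage_mono {X : Type u} [TopologicalSpace X] {p : ℕ}
    (e : OpenPartialHomeomorph X (Fin p → ℝ)) {W' W : Opens X} (h : W' ≤ W) :
    chartImage e W' ≤ chartImage e W := fun _ hx => ⟨hx.1, h hx.2⟩

/-- A chart of dimension `p|q`: an isomorphism of the restriction of `M` to an open subset with a
superdomain, that is, a homeomorphism onto an open subset of `ℝ^p` together with an isomorphism of
sheaves of superalgebras over it. -/
structure SuperChart (M : SuperSpace.{u}) (p q : ℕ) where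
  /-- the underlying homeomorphism -/
  homeo : OpenPartialHomeomorph M.space (Fin p → ℝ)
  /-- the isomorphisms of algebras of sections -/
  iso : ∀ W : Opens M.space, (W : Set M.space) ⊆ homeo.source →
    (M.sec W ≃ₐ[ℝ] SuperFun (Fin q) (chartImage homeo W))
  iso_parity : ∀ W hW (k : ZMod 2), ∀ f ∈ M.parity W k, iso W hW f ∈ SuperFun.parity k
  iso_res : ∀ (W W' : Opens M.space) hW hW' (h : W' ≤ W) (f : M.sec W),
    iso W' hW' (M.res h f) = SuperFun.restrict (chartImage_mono homeo h) (iso W hW f)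

/-- A smooth supermanifold of dimension `p|q`. -/
structure Supermanifold (p q : ℕ) extends SuperSpace.{u} where
  t2 : T2Space space
  secondCountable : SecondCountableTopology space
  exists_chart : ∀ x : space, ∃ c : SuperChart toSuperSpace p q, x ∈ c.homeo.source

namespace SuperChart

variable {M : SuperSpace.{u}} {p q : ℕ}

/-- The domain of a chart. -/
def dom (c : SuperChart M p q) : Opens M.space := ⟨c.homeo.source, c.homeo.open_source⟩

/-- The open subset of `ℝ^p` onto which the domain of the chart is mapped. -/
def img (c : SuperChart M p q) : Opens (Fin p → ℝ) := chartImage c.homeo c.dom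

/-- Functions on the domain of the chart, in terms of the coordinates. -/
def coordIso (c : SuperChart M p q) : M.sec c.dom ≃ₐ[ℝ] SuperFun (Fin q) c.img :=
  c.iso c.dom subset_rfl

/-- The coordinate expression of a global function. -/
def read (c : SuperChart M p q) (f : M.Fun) : SuperFun (Fin q) c.img :=
  c.coordIso (M.res le_top f)

/-- The image of the overlap of the domains of `c` and `c'`, in the coordinates of `c`. -/
def overlap (c c' : SuperChart M p q) : Opens (Fin p → ℝ) :=
  chartImage c.homeo (c.dom ⊓ c'.dom)

theorem overlap_le (c c' : SuperChart M p q) : c.overlap c' ≤ c.img :=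
  chartImage_mono c.homeo inf_le_left

/-- The image of the same overlap, in the coordinates of `c'`. -/
def overlap' (c c' : SuperChart M p q) : Opens (Fin p → ℝ) :=
  chartImage c'.homeo (c.dom ⊓ c'.dom)

theorem overlap'_le (c c' : SuperChart M p q) : c.overlap' c' ≤ c'.img :=
  chartImage_mono c'.homeo inf_le_right

/-- The change of coordinates on the overlap: a function expressed in the coordinates of `c'` is
expressed in the coordinates of `c`. -/
def transition (c c' : SuperChart M p q) :
    SuperFun (Fin q) (c.overlap' c') ≃ₐ[ℝ] SuperFun (Fin q) (c.overlap c') :=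
  (c'.iso (c.dom ⊓ c'.dom) fun _ hx => hx.2).symm.trans
    (c.iso (c.dom ⊓ c'.dom) fun _ hx => hx.1)

end SuperChart

/-- Functions on the cotangent bundle `T^*M`: one function of natural coordinates `(x^A, p_A)` for
every chart of `M`, related on overlaps by the induced changes of natural coordinates. -/
structure CotangentFun {p q : ℕ} (M : Supermanifold.{u} p q) where
  /-- the expression in the natural coordinates induced by a chart -/
  expr : ∀ c : SuperChart M.toSuperSpace p q, CotFun (Fin q) c.img
  compatible : ∀ c c' : SuperChart M.toSuperSpace p q,
    ∃ Φ : CotFun (Fin q) (c.overlap' c') →ₐ[ℝ] CotFun (Fin q) (c.overlap c'),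
      CotFun.IsCotangentLift (c.transition c') Φ ∧
      Φ (CotFun.restrict (c.overlap'_le c') (expr c')) =
        CotFun.restrict (c.overlap_le c') (expr c)

/-- A vector field of Grassmann parity `d`: a derivation of the structure sheaf. -/
structure SuperVectorField {p q : ℕ} (M : Supermanifold.{u} p q) (d : ZMod 2) where
  /-- the action on local functions -/
  app : ∀ U : Opens M.space, M.sec U →ₗ[ℝ] M.sec U
  app_parity : ∀ U (k : ZMod 2), ∀ f ∈ M.parity U k, app U f ∈ M.parity U (k + d)
  app_res : ∀ {U V : Opens M.space} (h : U ≤ V) (f : M.sec V),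
    app U (M.res h f) = M.res h (app V f)
  leibniz : ∀ U (k : ZMod 2), ∀ f ∈ M.parity U k, ∀ g : M.sec U,
    app U (f * g) = app U f * g + (-1 : ℝ) ^ (d * k).val • (f * app U g)

/-- The principal symbol `∑_A Q^A(x) p_A`, `Q^A = Q(x^A)`, of a vector field, in the natural
coordinates induced by a chart. -/
def SuperVectorField.symbol {p q : ℕ} {M : Supermanifold.{u} p q} {d : ZMod 2}
    (Q : SuperVectorField M d) (c : SuperChart M.toSuperSpace p q) : CotFun (Fin q) c.img :=
  ∑ A, CotFun.pullback (c.coordIso (Q.app c.dom (c.coordIso.symm (SuperFun.coord A)))) *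
    CotFun.momentum A

/-! ## Odd Jacobi structures -/

/-- An odd Jacobi structure `(S, Q)` on `M`. The Lie derivative of a function on `T^*M` along `Q`
is its Poisson bracket with the symbol of `Q`. -/
structure OddJacobiStructure {p q : ℕ} (M : Supermanifold.{u} p q) where
  /-- the almost Schouten structure -/
  S : CotangentFun M
  /-- the homological vector field -/
  Q : SuperVectorField M 1
  odd : ∀ c, S.expr c ∈ SuperFun.parity 1
  quadratic : ∀ c, CotFun.IsQuadratic (S.expr c)
  homological : ∀ (U : Opens M.space) (f : M.sec U), Q.app U (Q.app U f) = 0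
  invariance : ∀ c, CotFun.poisson (Q.symbol c) (S.expr c) = 0
  compatibility : ∀ c, CotFun.poisson (S.expr c) (S.expr c) =
    (-2 : ℝ) • (Q.symbol c * S.expr c)

/-- `B` is the odd Jacobi bracket of `(S, Q)`: the bilinear operation on `C^∞(M)` with
`⟦f,g⟧ = (-1)^{f̃+1} {{S,f},g} - (-1)^{f̃+1} {𝒬,fg}` for homogeneous `f, g`, as an identity of
functions on `T^*M`. -/
def IsOddJacobiBracket {p q : ℕ} {M : Supermanifold.{u} p q} (J : OddJacobiStructure M)
    (B : M.Fun →ₗ[ℝ] M.Fun →ₗ[ℝ] M.Fun) : Prop :=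
  ∀ i j : ZMod 2, ∀ f ∈ M.parity ⊤ i, ∀ g ∈ M.parity ⊤ j,
    ∀ c : SuperChart M.toSuperSpace p q,
      CotFun.pullback (c.read (B f g)) =
        (-1 : ℝ) ^ (i + 1).val •
            CotFun.poisson (CotFun.poisson (J.S.expr c) (CotFun.pullback (c.read f)))
              (CotFun.pullback (c.read g))
          - (-1 : ℝ) ^ (i + 1).val •
            CotFun.poisson (J.Q.symbol c) (CotFun.pullback (c.read (f * g)))

/-- The bilinear operation `B` makes the `ℤ/2`-graded algebra `A` an odd Jacobi algebra. -/
structure IsOddJacobiAlgebra {A : Type u} [Ring A] [Algebra ℝ A]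
    (par : ZMod 2 → Submodule ℝ A) (B : A →ₗ[ℝ] A →ₗ[ℝ] A) : Prop where
  grading : ∀ i j, ∀ f ∈ par i, ∀ g ∈ par j, B f g ∈ par (i + j + 1)
  skew : ∀ i j, ∀ f ∈ par i, ∀ g ∈ par j,
    B f g = -((-1 : ℝ) ^ ((i + 1) * (j + 1)).val • B g f)
  jacobi : ∀ i j k, ∀ f ∈ par i, ∀ g ∈ par j, ∀ h ∈ par k,
    (-1 : ℝ) ^ ((i + 1) * (k + 1)).val • B f (B g h)
      + (-1 : ℝ) ^ ((j + 1) * (i + 1)).val • B g (B h f)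
      + (-1 : ℝ) ^ ((k + 1) * (j + 1)).val • B h (B f g) = 0
  leibniz : ∀ i j k, ∀ f ∈ par i, ∀ g ∈ par j, ∀ h ∈ par k,
    B f (g * h) = B f g * h + (-1 : ℝ) ^ ((i + 1) * j).val • (g * B f h) - B f 1 * g * h

end

/-!
The bracket is a derived bracket. Write `K(f, g) = {{S, f}, g} - Q(fg)`, so that the odd Jacobi
bracket is `(-1)^{f̃ + 1} K(f, g)`. In natural coordinates the four axioms come from the canonical
Poisson bracket. As `S` is fibrewise quadratic, `{{S, f}, g}` is a function on the base. Since
functions on the base Poisson commute, the Jacobi identity of the Poisson bracket makes `{{S, f}, g}`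
graded symmetric in `f` and `g`, and it is a superderivation in each argument; this gives the
symmetry and the generalised Leibniz rule. The equation `{𝒬, S} = 0` says that `Q` is a derivation
of the derived bracket (`apply_derivedBracket`), and bracketing `{S, S} = -2 𝒬 S` with three
functions on the base computes its Jacobiator (`derivedBracket_jacobi`). In the Jacobiator of `K`
the terms with `Q` then cancel, by `Q² = 0` and supercommutativity (`symmetricBracket_jacobi`).

The analytic ingredient is that a superderivation of `C^∞(V) ⊗ Λ` is determined by its values on the
coordinates (`IsSuperDerivation.eq_zero`). It rests on Hadamard's lemma together with a bump
function, which shows that a point derivation of `C^∞(V)` only depends on the values at the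
coordinate functions. It is used three times: the Jacobi identity of the Poisson bracket is an
identity of superderivations, so it only has to be checked on coordinates (`poisson_jacobi`); a
vector field is `Q = ∑ Q(x^A) ∂/∂x^A`, so `{𝒬, f} = Q f` (`poisson_symbol_pullback`); and the
derivations `∂/∂x̄^A` of another chart satisfy the chain rule (`base_pderiv`), so the changes of
natural coordinates preserve the brackets `{F, f}` of polynomials in the momenta with functions on
the base (`map_poisson_of_isQuadratic`).

By this invariance the local functions `{{S, f}, g}` agree on overlaps of charts, and the sheaf
property glues them to a global function (`exists_derivedBracket`). Uniqueness and the axioms are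
checked in charts, because a global function is determined by its coordinate expressions and
pull-back to the cotangent bundle is injective.

To avoid homogeneity assumptions, the signs `(-1)^{k F̃} F` are written `sgn k F`, for the
automorphism `sgn k`, which is the identity or the parity involution.
-/

/-! ### The Grassmann algebra and partial derivatives of smooth functions -/

namespace Grassmann

variable {J : Type}

theorem ι_mul (v : J →₀ ℝ) (y : Grassmann J) :
    ExteriorAlgebra.ι ℝ v * y = CliffordAlgebra.involute y * ExteriorAlgebra.ι ℝ v := by
  induction y using ExteriorAlgebra.induction with
  | algebraMap r => rw [AlgHom.commutes]; exact (Algebra.commutes r _).symm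
  | ι x =>
    have h := ExteriorAlgebra.ι_add_mul_swap (R := ℝ) v x
    have h2 : CliffordAlgebra.involute (ExteriorAlgebra.ι ℝ x) = -ExteriorAlgebra.ι ℝ x :=
      CliffordAlgebra.involute_ι x
    rw [h2, neg_mul]
    exact eq_neg_of_add_eq_zero_left h
  | mul a b ha hb => rw [map_mul, ← mul_assoc, ha, mul_assoc, hb, mul_assoc]
  | add a b ha hb => rw [map_add, mul_add, add_mul, ha, hb]

/-- Graded commutativity, for factors that need not be homogeneous: `(x + involute x) / 2` is the
even part of `x`, which commutes with `y`, and `(x - involute x) / 2` is its odd part. -/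
theorem two_smul_mul (x y : Grassmann J) :
    (2 : ℝ) • (x * y) = y * (x + CliffordAlgebra.involute x) +
      CliffordAlgebra.involute y * (x - CliffordAlgebra.involute x) := by
  induction x using CliffordAlgebra.left_induction generalizing y with
  | algebraMap r =>
    rw [AlgHom.commutes, sub_self, mul_zero, add_zero, ← two_smul ℝ, mul_smul_comm,
      Algebra.commutes]
  | add a b ha hb =>
    rw [add_mul, smul_add, ha, hb]; simp only [map_add]; noncomm_ring
  | ι_mul x m hx =>
    have e : ∀ z : Grassmann J, CliffordAlgebra.ι 0 m * z =
      CliffordAlgebra.involute z * CliffordAlgebra.ι 0 m := ι_mul m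
    have e2 : ∀ z w : Grassmann J, CliffordAlgebra.ι 0 m * (z * w) =
      CliffordAlgebra.involute z * (CliffordAlgebra.ι 0 m * w) := fun z w => by
        rw [← mul_assoc, e, mul_assoc]
    rw [mul_assoc, ← mul_smul_comm, hx, mul_add, e2, e2, map_mul, CliffordAlgebra.involute_ι,
      CliffordAlgebra.involute_involute]
    noncomm_ring

theorem contractLeft_mul (d : Module.Dual ℝ (J →₀ ℝ)) (x y : Grassmann J) :
    CliffordAlgebra.contractLeft d (x * y) =
      CliffordAlgebra.contractLeft d x * y +
        CliffordAlgebra.involute x * CliffordAlgebra.contractLeft d y := by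
  induction x using CliffordAlgebra.left_induction with
  | algebraMap r =>
    rw [CliffordAlgebra.contractLeft_algebraMap_mul, CliffordAlgebra.contractLeft_algebraMap,
      AlgHom.commutes, zero_mul, zero_add]
  | add a b ha hb => simp only [add_mul, map_add, ha, hb]; abel
  | ι_mul x m hx =>
    rw [mul_assoc, CliffordAlgebra.contractLeft_ι_mul, CliffordAlgebra.contractLeft_ι_mul, hx,
      map_mul, CliffordAlgebra.involute_ι]
    simp only [Algebra.smul_def]
    noncomm_ring

theorem contractLeft_involute (d : Module.Dual ℝ (J →₀ ℝ)) (x : Grassmann J) :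
    CliffordAlgebra.contractLeft d (CliffordAlgebra.involute x) =
      -CliffordAlgebra.involute (CliffordAlgebra.contractLeft d x) := by
  induction x using CliffordAlgebra.left_induction with
  | algebraMap r => simp
  | add a b ha hb => simp only [map_add, ha, hb]; abel
  | ι_mul x m hx =>
    rw [map_mul, CliffordAlgebra.involute_ι, neg_mul, map_neg,
      CliffordAlgebra.contractLeft_ι_mul, CliffordAlgebra.contractLeft_ι_mul, hx,
      map_sub, map_mul, map_smul, CliffordAlgebra.involute_ι]
    noncomm_ring

end Grassmann

namespace SmoothFun

variable {I : Type} [Fintype I] {V : Opens (I → ℝ)}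

/-- The formula defining `pderiv`, for an arbitrary decidability instance on the index set. -/
theorem pderiv_apply (i : I) (f : SmoothFun V) (x : V) [DecidableEq I] :
    (pderiv i f).1 x = fderiv ℝ (extendZero f.1) x (Pi.single i 1) := by
  change fderiv ℝ (extendZero f.1) x _ = _
  congr!

theorem fderiv_congr {f : SmoothFun V} {F : (I → ℝ) → ℝ} (h : ∀ x : V, f.1 x = F x) (x : V) :
    fderiv ℝ (extendZero f.1) x = fderiv ℝ F x :=
  (SmoothFun.eventuallyEq h x).fderiv_eq

theorem pderiv_mul (i : I) (f g : SmoothFun V) :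
    pderiv i (f * g) = pderiv i f * g + f * pderiv i g := by
  classical
  ext x
  have h : fderiv ℝ (extendZero (f * g).1) x =
      fderiv ℝ (extendZero f.1 * extendZero g.1) x :=
    fderiv_congr (fun y => by simp [extendZero_coe]) x
  change (pderiv i (f * g)).1 x = (pderiv i f).1 x * g.1 x + f.1 x * (pderiv i g).1 x
  rw [pderiv_apply, pderiv_apply, pderiv_apply, h,
    fderiv_mul (differentiableAt f x) (differentiableAt g x)]
  simp [extendZero_coe]
  ring

theorem pderiv_comm (i j : I) (f : SmoothFun V) :
    pderiv i (pderiv j f) = pderiv j (pderiv i f) := by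
  classical
  ext x
  have key : ∀ i j : I, (pderiv i (pderiv j f)).1 x =
      fderiv ℝ (fderiv ℝ (extendZero f.1)) x (Pi.single i 1) (Pi.single j 1) := by
    intro i j
    rw [pderiv_apply, fderiv_congr (F := fun y => fderiv ℝ (extendZero f.1) y (Pi.single j 1))
      (fun y => pderiv_apply j f y) x,
      fderiv_clm_apply _ (differentiableAt_const _)]
    · simp
    · exact (((ContDiffOn.contDiffAt f.2 (V.isOpen.mem_nhds x.2)).fderiv_right
        (m := ∞) (by simp)).differentiableAt (by simp))
  rw [key, key]
  exact ((ContDiffOn.contDiffAt f.2 (V.isOpen.mem_nhds x.2)).isSymmSndFDerivAt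
    (by
      rw [minSmoothness_of_isRCLikeNormedField]
      exact WithTop.coe_le_coe.2 (le_top (a := (2 : ℕ∞))))).eq _ _

theorem pderiv_comap {I' : Type} [Fintype I'] {V' : Opens (I' → ℝ)}
    (φ : (I → ℝ) →L[ℝ] (I' → ℝ)) (h : ∀ x ∈ V, φ x ∈ V') (f : SmoothFun V') (i : I) (x : V)
    [DecidableEq I] :
    (pderiv i (comap φ φ.contDiff h f)).1 x =
      fderiv ℝ (extendZero f.1) (φ x) (φ (Pi.single i 1)) := by
  have hc := fderiv_comp (x : I → ℝ) (g := extendZero f.1) (f := φ)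
    (differentiableAt f ⟨φ x, h x x.2⟩) φ.differentiableAt
  rw [pderiv_apply, fderiv_congr (F := extendZero f.1 ∘ φ)
    (fun y => (extendZero_coe f.1 ⟨φ y, h y y.2⟩).symm) x]
  erw [hc]
  simp

theorem pderiv_mk_apply (i j : I) [DecidableEq I] :
    pderiv i (SmoothFun.mk (V := V) (fun x => x j) (contDiff_apply ℝ ℝ j)) =
      if j = i then 1 else 0 := by
  ext x
  rw [pderiv_apply, fderiv_congr (F := ContinuousLinearMap.proj (R := ℝ) j) (fun y => rfl) x,
    ContinuousLinearMap.fderiv]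
  by_cases h : j = i
  · subst h; simp
  · simp [h]

end SmoothFun

/-! ### Superfunctions: signs, supercommutativity and partial derivatives -/

/-- The sign `(-1)^k`. -/
noncomputable def paritySign (k : ZMod 2) : ℝ := (-1 : ℝ) ^ k.val

theorem paritySign_def (k : ZMod 2) : (-1 : ℝ) ^ k.val = paritySign k := rfl

@[simp] theorem paritySign_zero : paritySign 0 = 1 := by simp [paritySign]

@[simp] theorem paritySign_one : paritySign 1 = -1 := by
  simp [paritySign, show (1 : ZMod 2).val = 1 from rfl]

theorem ZMod.eq_zero_or_eq_one_of_two (k : ZMod 2) : k = 0 ∨ k = 1 := by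
  revert k; decide

theorem ZMod.one_add_one_of_two : (1 + 1 : ZMod 2) = 0 := rfl

theorem paritySign_add (k l : ZMod 2) : paritySign (k + l) = paritySign k * paritySign l := by
  rcases ZMod.eq_zero_or_eq_one_of_two k with rfl | rfl <;>
  rcases ZMod.eq_zero_or_eq_one_of_two l with rfl | rfl <;>
  simp [ZMod.one_add_one_of_two]

@[simp] theorem paritySign_mul_self (k : ZMod 2) : paritySign k * paritySign k = 1 := by
  rcases ZMod.eq_zero_or_eq_one_of_two k with rfl | rfl <;> simp

namespace SuperFun

variable {I J : Type} [Fintype I] {V : Opens (I → ℝ)}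

/-- The superfunction `f θ`. -/
noncomputable def tmul (f : SmoothFun V) (θ : Grassmann J) : SuperFun J V := f ⊗ₜ θ

@[elab_as_elim]
theorem induction {P : SuperFun J V → Prop} (F : SuperFun J V)
    (tmul : ∀ f θ, P (tmul f θ)) (add : ∀ F G, P F → P G → P (F + G)) : P F :=
  TensorProduct.induction_on F
    (by
      have h := tmul 0 0
      rwa [show SuperFun.tmul (0 : SmoothFun V) (0 : Grassmann J) = 0 from
        TensorProduct.zero_tmul _ _] at h) tmul add

theorem tmul_mul_tmul (f g : SmoothFun V) (θ η : Grassmann J) :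
    tmul f θ * tmul g η = tmul (f * g) (θ * η) :=
  Algebra.TensorProduct.tmul_mul_tmul f g θ η

theorem tmul_add (f : SmoothFun V) (θ η : Grassmann J) :
    tmul f (θ + η) = tmul f θ + tmul f η := TensorProduct.tmul_add _ _ _

theorem add_tmul (f g : SmoothFun V) (θ : Grassmann J) :
    tmul (f + g) θ = tmul f θ + tmul g θ := TensorProduct.add_tmul _ _ _

theorem tmul_smul (r : ℝ) (f : SmoothFun V) (θ : Grassmann J) :
    tmul f (r • θ) = r • tmul f θ := TensorProduct.tmul_smul _ _ _

theorem smul_tmul (r : ℝ) (f : SmoothFun V) (θ : Grassmann J) :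
    tmul (r • f) θ = r • tmul f θ := TensorProduct.smul_tmul' _ _ _

theorem tmul_neg (f : SmoothFun V) (θ : Grassmann J) :
    tmul f (-θ) = -tmul f θ := TensorProduct.tmul_neg _ _

theorem tmul_sub (f : SmoothFun V) (θ η : Grassmann J) :
    tmul f (θ - η) = tmul f θ - tmul f η := TensorProduct.tmul_sub _ _ _

theorem tmul_zero (f : SmoothFun V) : tmul f (0 : Grassmann J) = 0 := TensorProduct.tmul_zero _ _

theorem zero_tmul (θ : Grassmann J) : tmul (0 : SmoothFun V) θ = 0 := TensorProduct.zero_tmul _ _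

theorem tmul_one_one : tmul (1 : SmoothFun V) (1 : Grassmann J) = 1 := rfl

theorem invol_tmul (f : SmoothFun V) (θ : Grassmann J) :
    invol (tmul f θ) = tmul f (CliffordAlgebra.involute θ) := rfl

theorem restrict_tmul {V' : Opens (I → ℝ)} (h : V' ≤ V) (f : SmoothFun V) (θ : Grassmann J) :
    restrict h (tmul f θ) = tmul (SmoothFun.comap id contDiff_id h f) θ := rfl

theorem pderiv_inl_tmul (i : I) (f : SmoothFun V) (θ : Grassmann J) :
    pderiv (.inl i) (tmul f θ) = tmul (SmoothFun.pderiv i f) θ := rfl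

theorem pderiv_inr_tmul (j : J) (f : SmoothFun V) (θ : Grassmann J) :
    pderiv (.inr j) (tmul f θ) =
      tmul f (CliffordAlgebra.contractLeft (Finsupp.lapply j) θ) := rfl

@[simp] theorem invol_invol (F : SuperFun J V) : invol (invol F) = F := by
  induction F using SuperFun.induction with
  | tmul f θ => rw [invol_tmul, invol_tmul, CliffordAlgebra.involute_involute]
  | add F G hF hG => rw [map_add, map_add, hF, hG]

/-- The automorphism `F ↦ (-1)^{k F̃} F`. -/
noncomputable def sgn (k : ZMod 2) : SuperFun J V →ₐ[ℝ] SuperFun J V :=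
  if k = 0 then AlgHom.id ℝ _ else invol

@[simp] theorem sgn_zero (F : SuperFun J V) : sgn 0 F = F := by simp [sgn]

@[simp] theorem sgn_one (F : SuperFun J V) : sgn 1 F = invol F := by simp [sgn]

theorem sgn_sgn (k l : ZMod 2) (F : SuperFun J V) : sgn k (sgn l F) = sgn (k + l) F := by
  rcases ZMod.eq_zero_or_eq_one_of_two k with rfl | rfl <;>
  rcases ZMod.eq_zero_or_eq_one_of_two l with rfl | rfl <;>
  simp [ZMod.one_add_one_of_two]

@[simp] theorem sgn_sgn_self (k : ZMod 2) (F : SuperFun J V) : sgn k (sgn k F) = F := by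
  rw [sgn_sgn, CharTwo.add_self_eq_zero, sgn_zero]

theorem sgn_comm (k l : ZMod 2) (F : SuperFun J V) : sgn k (sgn l F) = sgn l (sgn k F) := by
  rw [sgn_sgn, sgn_sgn, add_comm]

theorem mem_parity_iff {k : ZMod 2} {F : SuperFun J V} :
    F ∈ parity k ↔ invol F = paritySign k • F := Iff.rfl

theorem sgn_of_mem {k : ZMod 2} {F : SuperFun J V} (h : F ∈ parity k) (l : ZMod 2) :
    sgn l F = paritySign (l * k) • F := by
  rcases ZMod.eq_zero_or_eq_one_of_two l with rfl | rfl
  · simp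
  · rw [sgn_one, one_mul, mem_parity_iff.1 h]

theorem mul_mem_parity {k l : ZMod 2} {F G : SuperFun J V} (hF : F ∈ parity k)
    (hG : G ∈ parity l) : F * G ∈ parity (k + l) := by
  rw [mem_parity_iff] at *
  rw [map_mul, hF, hG, paritySign_add, smul_mul_smul_comm]

theorem sgn_mem_parity {k : ZMod 2} {F : SuperFun J V} (hF : F ∈ parity k) (l : ZMod 2) :
    sgn l F ∈ parity k := by
  rw [sgn_of_mem hF]; exact Submodule.smul_mem _ _ hF

/-- The even part of a superfunction. -/
noncomputable def evenPart (F : SuperFun J V) : SuperFun J V := (1 / 2 : ℝ) • (F + invol F)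

/-- The odd part of a superfunction. -/
noncomputable def oddPart (F : SuperFun J V) : SuperFun J V := (1 / 2 : ℝ) • (F - invol F)

theorem evenPart_add_oddPart (F : SuperFun J V) : evenPart F + oddPart F = F := by
  unfold evenPart oddPart
  module

theorem evenPart_mem (F : SuperFun J V) : evenPart F ∈ parity 0 := by
  rw [mem_parity_iff, evenPart, map_smul, map_add, invol_invol, paritySign_zero]
  module

theorem oddPart_mem (F : SuperFun J V) : oddPart F ∈ parity 1 := by
  rw [mem_parity_iff, oddPart, map_smul, map_sub, invol_invol, paritySign_one]
  module

/-- Additive statements about superfunctions need only be checked on homogeneous ones. -/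
theorem homogeneous_induction {P : SuperFun J V → Prop} (F : SuperFun J V)
    (hom : ∀ k, ∀ F ∈ parity k, P F) (add : ∀ F G, P F → P G → P (F + G)) : P F := by
  rw [← evenPart_add_oddPart F]
  exact add _ _ (hom 0 _ (evenPart_mem F)) (hom 1 _ (oddPart_mem F))

theorem two_smul_mul (F G : SuperFun J V) :
    (2 : ℝ) • (F * G) = G * (F + invol F) + invol G * (F - invol F) := by
  induction F using SuperFun.induction with
  | add F F' hF hF' => simp only [add_mul, smul_add, hF, hF', map_add]; noncomm_ring
  | tmul f θ =>
  induction G using SuperFun.induction with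
  | add G G' hG hG' => simp only [mul_add, smul_add, hG, hG', map_add]; noncomm_ring
  | tmul g η =>
    simp only [invol_tmul, tmul_mul_tmul, ← tmul_add, ← tmul_sub, ← tmul_smul]
    rw [mul_comm g f, Grassmann.two_smul_mul]

/-- Supercommutativity: moving a homogeneous factor past `G` twists `G` by a sign. -/
theorem mul_comm_of_mem {k : ZMod 2} {F : SuperFun J V} (hF : F ∈ parity k)
    (G : SuperFun J V) : F * G = sgn k G * F := by
  have h := two_smul_mul F G
  rw [mem_parity_iff.1 hF] at h
  have h2 : (2 : ℝ) ≠ 0 := two_ne_zero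
  apply smul_right_injective _ h2
  change (2 : ℝ) • (F * G) = (2 : ℝ) • (sgn k G * F)
  rw [h]
  rcases ZMod.eq_zero_or_eq_one_of_two k with rfl | rfl
  · simp [two_smul, mul_add]
  · simp [two_smul, mul_add]

theorem supercomm {k l : ZMod 2} {F G : SuperFun J V} (hF : F ∈ parity k) (hG : G ∈ parity l) :
    F * G = paritySign (k * l) • (G * F) := by
  rw [mul_comm_of_mem hF, sgn_of_mem hG, smul_mul_assoc]


theorem pderiv_mul (a : I ⊕ J) (F G : SuperFun J V) :
    pderiv a (F * G) = pderiv a F * G + sgn (indexParity a) F * pderiv a G := by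
  induction F using SuperFun.induction with
  | add F F' hF hF' => simp only [add_mul, hF, hF', map_add]; abel
  | tmul f θ =>
  induction G using SuperFun.induction with
  | add G G' hG hG' => simp only [mul_add, hG, hG', map_add]; abel
  | tmul g η =>
    rcases a with i | j
    · simp only [indexParity, sgn_zero, pderiv_inl_tmul, tmul_mul_tmul, SmoothFun.pderiv_mul,
        add_tmul]
    · simp only [indexParity, sgn_one, pderiv_inr_tmul, tmul_mul_tmul, invol_tmul,
        Grassmann.contractLeft_mul, tmul_add]

theorem pderiv_sgn (a : I ⊕ J) (k : ZMod 2) (F : SuperFun J V) :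
    pderiv a (sgn k F) = paritySign (indexParity a * k) • sgn k (pderiv a F) := by
  rcases ZMod.eq_zero_or_eq_one_of_two k with rfl | rfl
  · simp
  induction F using SuperFun.induction with
  | add F F' hF hF' => simp only [hF, hF', map_add, smul_add]
  | tmul f θ =>
    rcases a with i | j
    · simp [indexParity, pderiv_inl_tmul, invol_tmul]
    · simp [indexParity, pderiv_inr_tmul, invol_tmul, Grassmann.contractLeft_involute, tmul_neg]

theorem pderiv_mem_parity (a : I ⊕ J) {k : ZMod 2} {F : SuperFun J V} (hF : F ∈ parity k) :
    pderiv a F ∈ parity (k + indexParity a) := by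
  have h := pderiv_sgn a 1 F
  rw [sgn_one, mem_parity_iff.1 hF, map_smul, sgn_one, mul_one] at h
  rw [mem_parity_iff, paritySign_add, mul_comm, mul_smul, h, smul_smul, paritySign_mul_self,
    one_smul]

theorem pderiv_comm (a b : I ⊕ J) (F : SuperFun J V) :
    pderiv a (pderiv b F) =
      paritySign (indexParity a * indexParity b) • pderiv b (pderiv a F) := by
  induction F using SuperFun.induction with
  | add F F' hF hF' => simp only [hF, hF', map_add, smul_add]
  | tmul f θ =>
    rcases a with i | j <;> rcases b with i' | j'
    · simp [indexParity, pderiv_inl_tmul, SmoothFun.pderiv_comm i i']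
    · simp [indexParity, pderiv_inl_tmul, pderiv_inr_tmul]
    · simp [indexParity, pderiv_inl_tmul, pderiv_inr_tmul]
    · simp only [indexParity, pderiv_inr_tmul, mul_one, paritySign_one, neg_smul, one_smul]
      rw [CliffordAlgebra.contractLeft_comm, tmul_neg]

theorem coord_mem_parity (a : I ⊕ J) : (coord a : SuperFun J V) ∈ parity (indexParity a) := by
  rw [mem_parity_iff]
  rcases a with i | j
  · rw [indexParity, paritySign_zero, one_smul]
    change invol (tmul _ _) = tmul _ _
    rw [invol_tmul, map_one]
  · rw [indexParity, paritySign_one, neg_smul, one_smul]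
    change invol (tmul _ _) = -tmul _ _
    rw [invol_tmul, ← tmul_neg]
    exact congrArg _ (CliffordAlgebra.involute_ι _)

theorem pderiv_coord [DecidableEq I] [DecidableEq J] (a b : I ⊕ J) :
    pderiv a (coord b : SuperFun J V) = if a = b then 1 else 0 := by
  rcases a with i | j <;> rcases b with i' | j'
  · change tmul (SmoothFun.pderiv i _) 1 = _
    rw [SmoothFun.pderiv_mk_apply]
    by_cases h : i' = i
    · simp [h, tmul_one_one]
    · simp [h, zero_tmul, Ne.symm h]
  · change tmul (SmoothFun.pderiv i 1) _ = _
    have : SmoothFun.pderiv i (1 : SmoothFun V) = 0 := by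
      have h := SmoothFun.pderiv_mul i (1 : SmoothFun V) 1
      rw [mul_one, mul_one, one_mul] at h
      exact left_eq_add.1 h
    rw [this, zero_tmul]; simp
  · change tmul _ (CliffordAlgebra.contractLeft _ 1) = _
    rw [CliffordAlgebra.contractLeft_one, tmul_zero]; simp
  · change tmul 1 (CliffordAlgebra.contractLeft _ (CliffordAlgebra.ι _ _)) = _
    rw [CliffordAlgebra.contractLeft_ι]
    by_cases h : j = j'
    · simp [h, tmul_one_one]
    · simp [h, tmul_zero]

end SuperFun

/-! ### Hadamard's lemma and point derivations -/

/-- Smooth dependence on parameters of an integral over the unit interval. -/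
theorem contDiff_integral_unitInterval {E : Type} [NormedAddCommGroup E] [NormedSpace ℝ E]
    [FiniteDimensional ℝ E] {G : Type} [NormedAddCommGroup G] [NormedSpace ℝ G] [CompleteSpace G]
    {F : E → ℝ → G} (hF : ContDiff ℝ ∞ (Function.uncurry F)) :
    ContDiff ℝ ∞ fun x => ∫ t in (0 : ℝ)..1, F x t := by
  rw [contDiff_infty]
  intro n
  induction n generalizing G with
  | zero =>
    exact contDiff_zero.2
      (intervalIntegral.continuous_parametric_intervalIntegral_of_continuous' hF.continuous 0 1)
  | succ n ih =>
    have : ProperSpace E := FiniteDimensional.proper ℝ E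
    let F' : E → ℝ → E →L[ℝ] G := fun x t =>
      (fderiv ℝ (Function.uncurry F) (x, t)).comp (ContinuousLinearMap.inl ℝ E ℝ)
    have hF' : ContDiff ℝ ∞ (Function.uncurry F') :=
      (hF.fderiv_right (m := ∞) (by simp)).clm_comp contDiff_const
    have hd : ∀ x t, HasFDerivAt (fun x => F x t) (F' x t) x := fun x t => by
      have h1 : HasFDerivAt (Function.uncurry F) (fderiv ℝ (Function.uncurry F) (x, t)) (x, t) :=
        (hF.differentiable (by simp) _).hasFDerivAt
      exact HasFDerivAt.comp (f := fun y => (y, t)) x h1 (hasFDerivAt_prodMk_left x t)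
    push_cast
    refine (contDiff_succ_iff_hasFDerivAt (n := n)).2
      ⟨fun x => ∫ t in (0 : ℝ)..1, F' x t, ih hF', fun x => ?_⟩
    obtain ⟨C, hC⟩ := ((isCompact_closedBall x 1).prod
      (isCompact_Icc (a := (0 : ℝ)) (b := 1))).exists_bound_of_continuousOn
        hF'.continuous.continuousOn
    have hc : ∀ y, Continuous (F y) := fun y =>
      hF.continuous.comp (Continuous.prodMk_right y)
    have hc' : ∀ y, Continuous (F' y) := fun y =>
      hF'.continuous.comp (Continuous.prodMk_right y)
    refine intervalIntegral.hasFDerivAt_integral_of_dominated_of_fderiv_le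
      (s := Metric.closedBall x 1) (bound := fun _ => C)
      (Metric.closedBall_mem_nhds x one_pos)
      (Filter.Eventually.of_forall fun y => (hc y).aestronglyMeasurable)
      ((hc x).intervalIntegrable _ _) (hc' x).aestronglyMeasurable
      (Filter.Eventually.of_forall fun t ht y hy => hC (y, t) ⟨hy, ?_⟩)
      intervalIntegrable_const
      (Filter.Eventually.of_forall fun t _ y _ => hd y t)
    rw [Set.uIoc_of_le zero_le_one] at ht
    exact ⟨ht.1.le, ht.2⟩

/-- Hadamard's lemma. -/
theorem exists_eq_add_sum_mul {I : Type} [Fintype I] {h : (I → ℝ) → ℝ} (hh : ContDiff ℝ ∞ h)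
    (a : I → ℝ) :
    ∃ g : I → (I → ℝ) → ℝ, (∀ i, ContDiff ℝ ∞ (g i)) ∧
      ∀ x, h x = h a + ∑ i, (x i - a i) * g i x := by
  classical
  have hline : ContDiff ℝ ∞ (fun z : (I → ℝ) × ℝ => a + z.2 • (z.1 - a)) := by fun_prop
  have hsm : ∀ i : I, ContDiff ℝ ∞ (Function.uncurry fun (x : I → ℝ) (t : ℝ) =>
      fderiv ℝ h (a + t • (x - a)) (Pi.single i 1)) := fun i =>
    ((hh.fderiv_right (m := ∞) (by simp)).comp hline).clm_apply contDiff_const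
  refine ⟨fun i x => ∫ t in (0 : ℝ)..1, fderiv ℝ h (a + t • (x - a)) (Pi.single i 1),
    fun i => contDiff_integral_unitInterval (hsm i), fun x => ?_⟩
  have hder : ∀ t : ℝ, HasDerivAt (fun t : ℝ => h (a + t • (x - a)))
      (fderiv ℝ h (a + t • (x - a)) (x - a)) t := fun t => by
    have h1 : HasFDerivAt h (fderiv ℝ h (a + t • (x - a))) (a + t • (x - a)) :=
      (hh.differentiable (by simp) _).hasFDerivAt
    have h2 : HasDerivAt (fun t : ℝ => a + t • (x - a)) (x - a) t := by
      simpa using ((hasDerivAt_id t).smul_const (x - a)).const_add a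
    exact h1.comp_hasDerivAt t h2
  have hcont : ∀ v : I → ℝ, Continuous fun t : ℝ => fderiv ℝ h (a + t • (x - a)) v := fun v =>
    ((hh.continuous_fderiv (by simp)).comp (by fun_prop)).clm_apply continuous_const
  have hint := intervalIntegral.integral_eq_sub_of_hasDerivAt (a := 0) (b := 1)
    (fun t _ => hder t) ((hcont _).intervalIntegrable _ _)
  have hsum : ∀ t : ℝ, fderiv ℝ h (a + t • (x - a)) (x - a) =
      ∑ i, (x i - a i) * fderiv ℝ h (a + t • (x - a)) (Pi.single i 1) := fun t => by
    generalize fderiv ℝ h (a + t • (x - a)) = L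
    conv_lhs => rw [pi_eq_sum_univ' (x - a)]
    simp [map_sum]
  simp_rw [hsum] at hint
  rw [intervalIntegral.integral_finsetSum
    (fun i _ => ((hcont _).const_mul _ |>.intervalIntegrable _ _))] at hint
  simp_rw [intervalIntegral.integral_const_mul] at hint
  rw [hint]
  simp

namespace SmoothFun

variable {I : Type} [Fintype I] {V : Opens (I → ℝ)}

/-- A bump function around a point of a neighbourhood contained in `V`. -/
theorem exists_bump (a : V) {U : Set (I → ℝ)} (hU : U ∈ nhds (a : I → ℝ)) :
    ∃ χ : (I → ℝ) → ℝ, ContDiff ℝ ∞ χ ∧ χ =ᶠ[nhds (a : I → ℝ)] 1 ∧ tsupport χ ⊆ U := by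
  obtain ⟨r, hr, hrU⟩ := Metric.nhds_basis_closedBall.mem_iff.1 hU
  let χ : ContDiffBump (a : I → ℝ) := ⟨r / 2, r, half_pos hr, half_lt_self hr⟩
  exact ⟨χ, χ.contDiff, χ.eventuallyEq_one, by rw [χ.tsupport_eq]; exact hrU⟩

/-- A smooth function on `V` agrees near a given point with a smooth function on the whole
space. -/
theorem exists_eventuallyEq_contDiff (f : SmoothFun V) (a : V) :
    ∃ h : (I → ℝ) → ℝ, ContDiff ℝ ∞ h ∧ extendZero f.1 =ᶠ[nhds (a : I → ℝ)] h := by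
  obtain ⟨χ, hχ, h1, hs⟩ := exists_bump a (V.isOpen.mem_nhds a.2)
  refine ⟨fun x => χ x * extendZero f.1 x, contDiff_iff_contDiffAt.2 fun x => ?_,
    h1.mono fun x hx => by simp [hx]⟩
  by_cases hx : x ∈ tsupport χ
  · exact hχ.contDiffAt.mul (ContDiffOn.contDiffAt f.2 (V.isOpen.mem_nhds (hs hx)))
  · refine contDiffAt_const (c := (0 : ℝ)) |>.congr_of_eventuallyEq ?_
    exact (notMem_tsupport_iff_eventuallyEq.1 hx).mono fun y hy => by simp [hy]

/-- A point derivation of `C^∞(V)` that vanishes on the coordinate functions is zero. -/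
theorem pointDerivation_eq_zero {W : Type} [AddCommGroup W] [Module ℝ W] (a : V)
    (δ : SmoothFun V →ₗ[ℝ] W) (hδ : ∀ f g, δ (f * g) = g.1 a • δ f + f.1 a • δ g)
    (hc : ∀ i, δ (SmoothFun.mk (fun x => x i) (contDiff_apply ℝ ℝ i)) = 0) (f : SmoothFun V) :
    δ f = 0 := by
  have h_one : δ 1 = 0 := by
    have h := hδ 1 1
    rw [mul_one, show (1 : SmoothFun V).1 a = 1 from rfl, one_smul] at h
    exact left_eq_add.1 h
  have h_const : ∀ r : ℝ, δ (algebraMap ℝ _ r) = 0 := fun r => by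
    rw [Algebra.algebraMap_eq_smul_one, map_smul, h_one, smul_zero]
  -- a point derivation only sees the germ at the point
  have h_local : ∀ u : SmoothFun V, extendZero u.1 =ᶠ[nhds (a : I → ℝ)] 0 → δ u = 0 := by
    intro u hu
    obtain ⟨χ, hχ, h1, hs⟩ := exists_bump a hu
    have hz : SmoothFun.mk χ hχ * u = 0 := by
      ext x
      change χ x * u.1 x = 0
      by_cases hx : (x : I → ℝ) ∈ tsupport χ
      · have : extendZero u.1 x = 0 := hs hx
        rw [← extendZero_coe u.1 x, this, mul_zero]
      · rw [image_eq_zero_of_notMem_tsupport hx, zero_mul]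
    have h := hδ (SmoothFun.mk χ hχ) u
    rw [hz, map_zero, show (SmoothFun.mk χ hχ).1 a = 1 from h1.self_of_nhds, one_smul,
      show u.1 a = 0 from (extendZero_coe u.1 a).symm.trans hu.self_of_nhds, zero_smul,
      zero_add] at h
    exact h.symm
  obtain ⟨h, hh, hfh⟩ := exists_eventuallyEq_contDiff f a
  obtain ⟨g, hg, hsum⟩ := exists_eq_add_sum_mul hh a
  have h0 : δ f = δ (SmoothFun.mk h hh) := by
    rw [← sub_eq_zero, ← map_sub]
    refine h_local _ ?_
    have h1 : extendZero (f - SmoothFun.mk h hh).1 =ᶠ[nhds (a : I → ℝ)]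
        extendZero f.1 - h := SmoothFun.eventuallyEq (fun y => by
      rw [Pi.sub_apply, extendZero_coe]; rfl) a
    exact h1.trans (hfh.mono fun y hy => by simp [hy])
  have h2 : SmoothFun.mk (V := V) h hh = algebraMap ℝ _ (h a) +
      ∑ i, (SmoothFun.mk (fun x => x i) (contDiff_apply ℝ ℝ i) - algebraMap ℝ _ (a.1 i)) *
        SmoothFun.mk (g i) (hg i) := by
    ext x
    rw [AddMemClass.coe_add, AddSubmonoidClass.coe_finsetSum, Pi.add_apply, Finset.sum_apply]
    exact hsum x
  rw [h0, h2, map_add, h_const, zero_add, map_sum]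
  refine Finset.sum_eq_zero fun i _ => ?_
  rw [hδ, map_sub, hc, h_const, sub_zero, smul_zero, zero_add]
  have : (SmoothFun.mk (V := V) (fun x => x i) (contDiff_apply ℝ ℝ i) -
    algebraMap ℝ _ (a.1 i)).1 a = 0 := sub_self (a.1 i)
  rw [this, zero_smul]

end SmoothFun

/-! ### Superderivations are determined by the coordinates -/

namespace SuperFun

variable {I J : Type} [Fintype I] {V : Opens (I → ℝ)}

/-- The value of a superfunction at a point of the body, an element of the Grassmann algebra. -/
noncomputable def eval (a : V) : SuperFun J V →ₐ[ℝ] Grassmann J :=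
  (Algebra.TensorProduct.lid ℝ (Grassmann J)).toAlgHom.comp
    (Algebra.TensorProduct.map ((Pi.evalAlgHom ℝ (fun _ : V => ℝ) a).comp (SmoothFun V).val)
      (AlgHom.id ℝ _))

theorem eval_tmul (a : V) (f : SmoothFun V) (θ : Grassmann J) :
    eval a (tmul f θ) = f.1 a • θ := rfl

/-- Superfunctions are determined by their values in the Grassmann algebra at the points of the
body. -/
theorem eq_zero_of_eval {F : SuperFun J V} (h : ∀ a, eval a F = 0) : F = 0 := by
  classical
  let b := Module.Basis.ofVectorSpace ℝ (Grassmann J)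
  let e : SuperFun J V ≃ₗ[ℝ] _ := TensorProduct.equivFinsuppOfBasisRight (M := SmoothFun V) b
  have key : ∀ (F : SuperFun J V) a i, (e F i).1 a = b.repr (eval a F) i := by
    intro F a i
    induction F using SuperFun.induction with
    | tmul f θ =>
      have h1 : e (tmul f θ) i = b.repr θ i • f :=
        TensorProduct.equivFinsuppOfBasisRight_apply_tmul_apply b f θ i
      rw [h1, eval_tmul, map_smul]
      change b.repr θ i * f.1 a = f.1 a * b.repr θ i
      rw [mul_comm]
    | add F G hF hG =>
      rw [map_add, map_add, map_add, Finsupp.add_apply, Finsupp.add_apply, ← hF, ← hG]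
      rfl
  apply e.injective
  rw [map_zero]
  ext i a
  rw [key, h, map_zero]
  rfl

/-- A superderivation of parity `k` of the algebra of superfunctions. -/
structure IsSuperDerivation (k : ZMod 2) (D : SuperFun J V →ₗ[ℝ] SuperFun J V) : Prop where
  map_invol : ∀ F, D (invol F) = paritySign k • invol (D F)
  leibniz : ∀ F G, D (F * G) = D F * G + sgn k F * D G

theorem isSuperDerivation_pderiv (a : I ⊕ J) :
    IsSuperDerivation (V := V) (indexParity a) (pderiv a) where
  map_invol F := by simpa using pderiv_sgn a 1 F
  leibniz := pderiv_mul a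

namespace IsSuperDerivation

variable {k l : ZMod 2} {D E : SuperFun J V →ₗ[ℝ] SuperFun J V}

theorem map_sgn (hD : IsSuperDerivation k D) (m : ZMod 2) (F : SuperFun J V) :
    D (sgn m F) = paritySign (k * m) • sgn m (D F) := by
  rcases ZMod.eq_zero_or_eq_one_of_two m with rfl | rfl
  · simp
  · rw [sgn_one, sgn_one, hD.map_invol, mul_one]

theorem mem_parity (hD : IsSuperDerivation k D) {m : ZMod 2} {F : SuperFun J V}
    (hF : F ∈ parity m) : D F ∈ parity (m + k) := by
  have h := hD.map_invol F
  rw [mem_parity_iff.1 hF, map_smul] at h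
  rw [mem_parity_iff, paritySign_add, mul_comm, mul_smul, h, smul_smul, paritySign_mul_self,
    one_smul]

theorem apply_one (hD : IsSuperDerivation k D) : D 1 = 0 := by
  have h := hD.leibniz 1 1
  rw [mul_one, mul_one, map_one (sgn k), one_mul] at h
  exact left_eq_add.1 h

theorem add (hD : IsSuperDerivation k D) (hE : IsSuperDerivation k E) :
    IsSuperDerivation k (D + E) where
  map_invol F := by simp [hD.map_invol, hE.map_invol]
  leibniz F G := by simp only [LinearMap.add_apply, hD.leibniz, hE.leibniz]; noncomm_ring

theorem zero : IsSuperDerivation k (0 : SuperFun J V →ₗ[ℝ] SuperFun J V) where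
  map_invol F := by simp
  leibniz F G := by simp

theorem smul (hD : IsSuperDerivation k D) (r : ℝ) : IsSuperDerivation k (r • D) where
  map_invol F := by simp [hD.map_invol, smul_comm r]
  leibniz F G := by simp [hD.leibniz]

theorem sub (hD : IsSuperDerivation k D) (hE : IsSuperDerivation k E) :
    IsSuperDerivation k (D - E) := by
  rw [show D - E = D + (-1 : ℝ) • E by module]
  exact hD.add (hE.smul (-1))

theorem sum {ι : Type} (s : Finset ι) {D : ι → SuperFun J V →ₗ[ℝ] SuperFun J V}
    (hD : ∀ i ∈ s, IsSuperDerivation k (D i)) : IsSuperDerivation k (∑ i ∈ s, D i) :=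
  Finset.sum_induction D (IsSuperDerivation k) (fun _ _ => add) zero hD

theorem mulLeft (hD : IsSuperDerivation k D) {G : SuperFun J V} (hG : G ∈ parity l) :
    IsSuperDerivation (l + k) (LinearMap.mulLeft ℝ G ∘ₗ D) where
  map_invol F := by
    rw [LinearMap.comp_apply, LinearMap.comp_apply, LinearMap.mulLeft_apply,
      LinearMap.mulLeft_apply, hD.map_invol, map_mul, mem_parity_iff.1 hG, paritySign_add,
      smul_mul_assoc, mul_smul_comm, smul_smul, mul_right_comm, paritySign_mul_self, one_mul]
  leibniz F H := by
    simp only [LinearMap.comp_apply, LinearMap.mulLeft_apply, hD.leibniz, mul_add]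
    rw [← mul_assoc G (sgn k F), mul_comm_of_mem hG (sgn k F), sgn_sgn, mul_assoc, mul_assoc]

/-- The supercommutator of two superderivations is a superderivation. -/
theorem comp_sub_comp (hD : IsSuperDerivation k D) (hE : IsSuperDerivation l E) :
    IsSuperDerivation (k + l) (D ∘ₗ E - paritySign (k * l) • E ∘ₗ D) where
  map_invol F := by
    simp only [LinearMap.sub_apply, LinearMap.comp_apply, LinearMap.smul_apply, hD.map_invol,
      hE.map_invol, map_smul, paritySign_add, map_sub]
    module
  leibniz F G := by
    simp only [LinearMap.sub_apply, LinearMap.comp_apply, LinearMap.smul_apply, hD.leibniz,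
      hE.leibniz, map_add, hD.map_sgn, hE.map_sgn]
    rw [sgn_sgn, sgn_sgn, add_comm l k]
    simp only [sub_mul, smul_mul_assoc, mul_sub, mul_smul_comm, smul_add, smul_smul,
      mul_comm l k, paritySign_mul_self, one_smul]
    rcases ZMod.eq_zero_or_eq_one_of_two k with rfl | rfl <;>
    rcases ZMod.eq_zero_or_eq_one_of_two l with rfl | rfl <;>
    simp [ZMod.one_add_one_of_two] <;> abel

/-- A superderivation that vanishes on the coordinates is zero. -/
theorem eq_zero (hD : IsSuperDerivation k D) (hc : ∀ a, D (coord a) = 0) : D = 0 := by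
  have hι : ∀ v : J →₀ ℝ, D (tmul 1 (ExteriorAlgebra.ι ℝ v)) = 0 := by
    intro v
    induction v using Finsupp.induction_linear with
    | zero => rw [map_zero, tmul_zero, map_zero]
    | add v w hv hw => rw [map_add, tmul_add, map_add, hv, hw, add_zero]
    | single j r =>
      rw [show Finsupp.single j r = r • Finsupp.single j (1 : ℝ) by simp, map_smul, tmul_smul,
        map_smul]
      exact (congrArg (r • ·) (hc (.inr j))).trans (smul_zero r)
  have hodd : ∀ θ : Grassmann J, D (tmul 1 θ) = 0 := by
    intro θ
    induction θ using ExteriorAlgebra.induction with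
    | algebraMap r =>
      rw [Algebra.algebraMap_eq_smul_one, tmul_smul, tmul_one_one, map_smul, hD.apply_one,
        smul_zero]
    | ι v => exact hι v
    | mul x y hx hy =>
      rw [show tmul (1 : SmoothFun V) (x * y) = tmul 1 x * tmul 1 y by
        rw [tmul_mul_tmul, one_mul], hD.leibniz, hx, hy, zero_mul, mul_zero, add_zero]
    | add x y hx hy => rw [tmul_add, map_add, hx, hy, add_zero]
  have hsgn : ∀ f : SmoothFun V, sgn k (tmul f (1 : Grassmann J)) = tmul f 1 := fun f => by
    rcases ZMod.eq_zero_or_eq_one_of_two k with rfl | rfl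
    · rw [sgn_zero]
    · rw [sgn_one, invol_tmul, map_one]
  have heven : ∀ f : SmoothFun V, D (tmul f 1) = 0 := by
    intro f
    refine eq_zero_of_eval fun a => ?_
    let δ : SmoothFun V →ₗ[ℝ] Grassmann J :=
      { toFun := fun f => eval a (D (tmul f 1))
        map_add' := fun f g => by rw [add_tmul, map_add, map_add]
        map_smul' := fun r f => by rw [smul_tmul, map_smul, map_smul]; rfl }
    refine SmoothFun.pointDerivation_eq_zero a δ (fun f g => ?_) (fun i => ?_) f
    · change eval a (D (tmul (f * g) 1)) = g.1 a • eval a (D (tmul f 1)) +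
        f.1 a • eval a (D (tmul g 1))
      rw [show tmul (f * g) (1 : Grassmann J) = tmul f 1 * tmul g 1 by
        rw [tmul_mul_tmul, one_mul], hD.leibniz, map_add, map_mul, map_mul, hsgn,
        eval_tmul, eval_tmul]
      simp
    · exact (congrArg (eval a) (hc (.inl i))).trans (map_zero _)
  ext F
  induction F using SuperFun.induction with
  | tmul f θ =>
    rw [show tmul f θ = tmul f 1 * tmul 1 θ by rw [tmul_mul_tmul, mul_one, one_mul], hD.leibniz,
      heven, hodd, zero_mul, mul_zero, add_zero]
    rfl
  | add F G hF hG => rw [map_add, map_add, hF, hG]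

/-- A superderivation is determined by its values on the coordinates:
`D = ∑_A D(x^A) ∂/∂x^A`. -/
theorem apply_eq_sum [Fintype J] (hD : IsSuperDerivation k D) (F : SuperFun J V) :
    D F = ∑ a, D (coord a) * pderiv a F := by
  classical
  have h1 : ∀ a : I ⊕ J, IsSuperDerivation k (LinearMap.mulLeft ℝ (D (coord a)) ∘ₗ pderiv a) :=
    fun a => by
      have h := (isSuperDerivation_pderiv a).mulLeft (hD.mem_parity (coord_mem_parity a))
      rwa [show indexParity a + k + indexParity a = k by
        rw [add_right_comm, CharTwo.add_self_eq_zero, zero_add]] at h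
  have h2 := (hD.sub (IsSuperDerivation.sum Finset.univ fun a _ => h1 a)).eq_zero fun b => by
    simp only [LinearMap.sub_apply, LinearMap.sum_apply, LinearMap.comp_apply,
      LinearMap.mulLeft_apply, pderiv_coord, mul_ite, mul_one, mul_zero, Finset.sum_ite_eq',
      Finset.mem_univ, if_true, sub_self]
  have h3 := LinearMap.congr_fun h2 F
  simpa [sub_eq_zero] using h3

end IsSuperDerivation

end SuperFun

/-! ### The canonical Poisson bracket -/

namespace CotFun

open SuperFun

variable {I J : Type}

@[simp] theorem indexParity_pos (A : I ⊕ J) : indexParity (pos A) = indexParity A := by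
  cases A <;> rfl

@[simp] theorem indexParity_mom (A : I ⊕ J) : indexParity (mom A) = indexParity A := by
  cases A <;> rfl

theorem pos_injective : Function.Injective (pos : I ⊕ J → (I ⊕ I) ⊕ (J ⊕ J)) :=
  Sum.map_injective.2 ⟨Sum.inl_injective, Sum.inl_injective⟩

theorem mom_injective : Function.Injective (mom : I ⊕ J → (I ⊕ I) ⊕ (J ⊕ J)) :=
  Sum.map_injective.2 ⟨Sum.inr_injective, Sum.inr_injective⟩

theorem pos_ne_mom (A B : I ⊕ J) : pos A ≠ mom B := by
  cases A <;> cases B <;> simp [pos, mom]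

theorem eq_pos_or_eq_mom (a : (I ⊕ I) ⊕ (J ⊕ J)) : ∃ A, a = pos A ∨ a = mom A := by
  rcases a with (i | i) | (j | j)
  exacts [⟨.inl i, .inl rfl⟩, ⟨.inl i, .inr rfl⟩, ⟨.inr j, .inl rfl⟩, ⟨.inr j, .inr rfl⟩]

variable [Fintype I] [Fintype J] {V : Opens (I → ℝ)}

/-- The Poisson bracket with the signs applied after differentiation:
`∂(σ F) = (-1)^Ã σ (∂ F)` for `σ F = (-1)^{Ã F̃} F`. -/
theorem poisson_eq_sum (F G : CotFun J V) :
    poisson F G = ∑ A : I ⊕ J,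
      (sgn (indexParity A) (pderiv (mom A) F) * pderiv (pos A) G -
        paritySign (indexParity A) •
          (sgn (indexParity A) (pderiv (pos A) F) * pderiv (mom A) G)) := by
  refine Finset.sum_congr rfl fun A _ => ?_
  have hk : koszul A F = sgn (indexParity A) F := by
    rw [koszul, sgn]; split_ifs <;> rfl
  rw [hk, pderiv_sgn, pderiv_sgn, indexParity_mom, indexParity_pos, paritySign_def]
  rcases ZMod.eq_zero_or_eq_one_of_two (indexParity A) with h | h <;> rw [h] <;> simp

theorem poisson_add_left (F F' G : CotFun J V) :
    poisson (F + F') G = poisson F G + poisson F' G := by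
  simp only [poisson_eq_sum, map_add, add_mul, smul_add, ← Finset.sum_add_distrib]
  exact Finset.sum_congr rfl fun _ _ => by abel

theorem poisson_add_right (F G G' : CotFun J V) :
    poisson F (G + G') = poisson F G + poisson F G' := by
  simp only [poisson_eq_sum, map_add, mul_add, smul_add, ← Finset.sum_add_distrib]
  exact Finset.sum_congr rfl fun _ _ => by abel

theorem poisson_smul_left (r : ℝ) (F G : CotFun J V) :
    poisson (r • F) G = r • poisson F G := by
  simp only [poisson_eq_sum, map_smul, smul_mul_assoc, Finset.smul_sum, smul_sub, smul_comm r]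

theorem poisson_smul_right (r : ℝ) (F G : CotFun J V) :
    poisson F (r • G) = r • poisson F G := by
  simp only [poisson_eq_sum, map_smul, mul_smul_comm, Finset.smul_sum, smul_sub, smul_comm r]

/-- The Poisson bracket as a bilinear map. -/
noncomputable def poissonLinear : CotFun J V →ₗ[ℝ] CotFun J V →ₗ[ℝ] CotFun J V :=
  LinearMap.mk₂ ℝ poisson poisson_add_left poisson_smul_left poisson_add_right
    poisson_smul_right

theorem poissonLinear_apply (F G : CotFun J V) : poissonLinear F G = poisson F G := rfl

theorem poisson_neg_left (F G : CotFun J V) : poisson (-F) G = -poisson F G := by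
  rw [← poissonLinear_apply, map_neg]; rfl

theorem poisson_neg_right (F G : CotFun J V) : poisson F (-G) = -poisson F G :=
  map_neg (poissonLinear F) G

theorem poisson_sum_left {ι : Type} (s : Finset ι) (F : ι → CotFun J V) (G : CotFun J V) :
    poisson (∑ i ∈ s, F i) G = ∑ i ∈ s, poisson (F i) G := by
  rw [← poissonLinear_apply, map_sum, LinearMap.sum_apply]; rfl

theorem sgn_poisson (k : ZMod 2) (F G : CotFun J V) :
    sgn k (poisson F G) = poisson (sgn k F) (sgn k G) := by
  rw [poisson_eq_sum, poisson_eq_sum, map_sum]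
  refine Finset.sum_congr rfl fun A _ => ?_
  simp only [map_sub, map_mul, map_smul, pderiv_sgn, indexParity_mom, indexParity_pos,
    smul_mul_smul_comm, paritySign_mul_self, one_smul, sgn_comm k]

theorem poisson_mem_parity {k l : ZMod 2} {F G : CotFun J V} (hF : F ∈ parity k)
    (hG : G ∈ parity l) : poisson F G ∈ parity (k + l) := by
  have h := sgn_poisson 1 F G
  rw [sgn_one, sgn_one, sgn_one, mem_parity_iff.1 hF, mem_parity_iff.1 hG, poisson_smul_left,
    poisson_smul_right, smul_smul, ← paritySign_add] at h
  exact h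

theorem poisson_mul_right {k : ZMod 2} {F : CotFun J V} (hF : F ∈ parity k) (G H : CotFun J V) :
    poisson F (G * H) = poisson F G * H + sgn k G * poisson F H := by
  simp only [poisson_eq_sum, Finset.sum_mul, Finset.mul_sum, ← Finset.sum_add_distrib]
  refine Finset.sum_congr rfl fun A _ => ?_
  have key : ∀ X ∈ (parity (k + indexParity A) : Submodule ℝ (CotFun J V)),
      ∀ Y, X * (sgn (indexParity A) G * Y) = sgn k G * (X * Y) := by
    intro X hX Y
    rw [← mul_assoc, mul_comm_of_mem hX, sgn_sgn, add_assoc, CharTwo.add_self_eq_zero, add_zero,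
      mul_assoc]
  have h1 := pderiv_mem_parity (mom A) hF
  have h2 := pderiv_mem_parity (pos A) hF
  rw [indexParity_mom] at h1
  rw [indexParity_pos] at h2
  rw [pderiv_mul, pderiv_mul, indexParity_mom, indexParity_pos, mul_add, mul_add,
    key _ (sgn_mem_parity h1 _), key _ (sgn_mem_parity h2 _)]
  simp only [mul_assoc, smul_mul_assoc, mul_smul_comm, sub_mul, mul_sub, smul_add]
  abel

theorem poisson_mul_left {k : ZMod 2} {H : CotFun J V} (hH : H ∈ parity k) (F G : CotFun J V) :
    poisson (F * G) H = F * poisson G H + poisson F H * sgn k G := by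
  simp only [poisson_eq_sum, Finset.sum_mul, Finset.mul_sum, ← Finset.sum_add_distrib]
  refine Finset.sum_congr rfl fun A _ => ?_
  have key : ∀ X ∈ (parity (k + indexParity A) : Submodule ℝ (CotFun J V)),
      ∀ Y, Y * sgn (indexParity A) G * X = Y * X * sgn k G := by
    intro X hX Y
    rw [mul_assoc, mul_assoc, mul_comm_of_mem hX, sgn_sgn, add_right_comm,
      CharTwo.add_self_eq_zero, zero_add]
  have h1 := pderiv_mem_parity (mom A) hH
  have h2 := pderiv_mem_parity (pos A) hH
  rw [indexParity_mom] at h1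
  rw [indexParity_pos] at h2
  rw [pderiv_mul, pderiv_mul, indexParity_mom, indexParity_pos, map_add, map_add, map_mul,
    map_mul, map_mul, map_mul, add_mul, add_mul, key _ h1, key _ h2, sgn_sgn_self]
  simp only [mul_assoc, smul_mul_assoc, mul_smul_comm, sub_mul, mul_sub, smul_add]
  abel

theorem poisson_antisymm {l : ZMod 2} {G : CotFun J V} (hG : G ∈ parity l) (F : CotFun J V) :
    poisson F G = -poisson G (sgn l F) := by
  rw [poisson_eq_sum, poisson_eq_sum, ← Finset.sum_neg_distrib]
  refine Finset.sum_congr rfl fun A _ => ?_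
  have h1 := pderiv_mem_parity (mom A) hG
  have h2 := pderiv_mem_parity (pos A) hG
  rw [indexParity_mom] at h1
  rw [indexParity_pos] at h2
  rw [mul_comm_of_mem (sgn_mem_parity h1 _), mul_comm_of_mem (sgn_mem_parity h2 _), sgn_of_mem h1,
    sgn_of_mem h2, pderiv_sgn, pderiv_sgn, indexParity_mom, indexParity_pos]
  simp only [map_smul, sgn_sgn, smul_mul_assoc, mul_smul_comm, smul_smul]
  rcases ZMod.eq_zero_or_eq_one_of_two l with rfl | rfl <;>
  rcases ZMod.eq_zero_or_eq_one_of_two (indexParity A) with h | h <;> rw [h] <;>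
  simp [ZMod.one_add_one_of_two]

theorem pderiv_poisson (c : (I ⊕ I) ⊕ (J ⊕ J)) (F G : CotFun J V) :
    pderiv c (poisson F G) =
      poisson (pderiv c F) G + poisson (sgn (indexParity c) F) (pderiv c G) := by
  simp only [poisson_eq_sum, map_sum, ← Finset.sum_add_distrib]
  refine Finset.sum_congr rfl fun A _ => ?_
  simp only [map_sub, map_smul, pderiv_mul, pderiv_sgn, smul_add, smul_mul_assoc, mul_smul_comm,
    smul_smul, indexParity_mom, indexParity_pos, pderiv_comm c (mom A), pderiv_comm c (pos A),
    paritySign_mul_self, one_smul, sgn_comm (indexParity c) (indexParity A),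
    mul_comm (indexParity c) (indexParity A)]
  abel

theorem isSuperDerivation_poisson {k : ZMod 2} {F : CotFun J V} (hF : F ∈ parity k) :
    IsSuperDerivation k (poissonLinear F) where
  map_invol G := by
    have h := sgn_poisson 1 F G
    rw [sgn_one, sgn_one, sgn_one, mem_parity_iff.1 hF, poisson_smul_left] at h
    rw [poissonLinear_apply, poissonLinear_apply, h, smul_smul, paritySign_mul_self, one_smul]
  leibniz := poisson_mul_right hF

theorem poisson_coord_pos (F : CotFun J V) (A : I ⊕ J) :
    poisson F (coord (pos A)) = sgn (indexParity A) (pderiv (mom A) F) := by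
  classical
  rw [poisson_eq_sum, Finset.sum_eq_single A]
  · simp [pderiv_coord, (pos_ne_mom A A).symm]
  · intro B _ hB
    simp [pderiv_coord, pos_injective.eq_iff, hB, (pos_ne_mom A B).symm]
  · simp

theorem poisson_coord_mom (F : CotFun J V) (A : I ⊕ J) :
    poisson F (coord (mom A)) =
      -(paritySign (indexParity A) • sgn (indexParity A) (pderiv (pos A) F)) := by
  classical
  rw [poisson_eq_sum, Finset.sum_eq_single A]
  · simp [pderiv_coord, pos_ne_mom A A]
  · intro B _ hB
    simp [pderiv_coord, mom_injective.eq_iff, hB, pos_ne_mom B A]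
  · simp

/-- The Jacobi identity of the canonical Poisson bracket. Both sides are superderivations in `H`,
so it is enough to compare them on the coordinates, where the identity says that the partial
derivatives are derivations of the bracket. -/
theorem poisson_jacobi {k l : ZMod 2} {F G : CotFun J V} (hF : F ∈ parity k) (hG : G ∈ parity l)
    (H : CotFun J V) :
    poisson F (poisson G H) =
      poisson (poisson F G) H + paritySign (k * l) • poisson G (poisson F H) := by
  have key : ∀ c : (I ⊕ I) ⊕ (J ⊕ J),
      poisson F (sgn (indexParity c) (pderiv c G)) -
        paritySign (k * l) • poisson G (sgn (indexParity c) (pderiv c F)) -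
        sgn (indexParity c) (pderiv c (poisson F G)) = 0 := by
    intro c
    have hX := sgn_mem_parity (pderiv_mem_parity c hF) (indexParity c)
    rw [pderiv_poisson, map_add, sgn_poisson, sgn_poisson, sgn_sgn_self,
      sgn_of_mem hG, poisson_smul_right, poisson_antisymm hG, sgn_of_mem hX, poisson_smul_right,
      smul_neg, smul_smul, ← paritySign_add,
      show indexParity c * l + l * (k + indexParity c) = k * l by
        linear_combination (indexParity c * l) * (ZMod.one_add_one_of_two)]
    abel
  have hD := ((isSuperDerivation_poisson hF).comp_sub_comp (isSuperDerivation_poisson hG)).sub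
    (isSuperDerivation_poisson (poisson_mem_parity hF hG))
  have h0 := hD.eq_zero fun a => by
    simp only [LinearMap.sub_apply, LinearMap.comp_apply, LinearMap.smul_apply,
      poissonLinear_apply]
    obtain ⟨A, rfl | rfl⟩ := eq_pos_or_eq_mom a
    · have h := key (mom A)
      rw [indexParity_mom] at h
      rw [poisson_coord_pos, poisson_coord_pos, poisson_coord_pos, h]
    · have h := key (pos A)
      rw [indexParity_pos] at h
      rw [poisson_coord_mom, poisson_coord_mom, poisson_coord_mom, poisson_neg_right,
        poisson_neg_right, poisson_smul_right, poisson_smul_right, smul_neg, smul_comm,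
        ← neg_eq_zero, ← smul_zero (paritySign (indexParity A)), ← h]
      module
  have h1 := LinearMap.congr_fun h0 H
  simp only [LinearMap.sub_apply, LinearMap.comp_apply, poissonLinear_apply,
    LinearMap.zero_apply, sub_sub, sub_eq_zero] at h1
  rw [h1, add_comm]
  rfl

end CotFun

/-! ### Functions on the base, fibre degree, and changes of natural coordinates -/

theorem Grassmann.contractLeft_map {J J' : Type} (φ : (J →₀ ℝ) →ₗ[ℝ] (J' →₀ ℝ))
    (d : Module.Dual ℝ (J' →₀ ℝ)) (x : Grassmann J) :
    CliffordAlgebra.contractLeft d (ExteriorAlgebra.map φ x) =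
      ExteriorAlgebra.map φ (CliffordAlgebra.contractLeft (d ∘ₗ φ) x) := by
  induction x using CliffordAlgebra.left_induction with
  | algebraMap r => simp
  | add a b ha hb => simp only [map_add, ha, hb]
  | ι_mul x m hx =>
    have e : ExteriorAlgebra.map φ (CliffordAlgebra.ι 0 m) = CliffordAlgebra.ι 0 (φ m) :=
      ExteriorAlgebra.map_apply_ι φ m
    rw [map_mul, e, CliffordAlgebra.contractLeft_ι_mul, CliffordAlgebra.contractLeft_ι_mul, hx,
      map_sub, map_smul, map_mul, e]
    rfl

theorem Grassmann.involute_map {J J' : Type} (φ : (J →₀ ℝ) →ₗ[ℝ] (J' →₀ ℝ)) (x : Grassmann J) :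
    CliffordAlgebra.involute (ExteriorAlgebra.map φ x) =
      ExteriorAlgebra.map φ (CliffordAlgebra.involute x) := by
  induction x using CliffordAlgebra.left_induction with
  | algebraMap r => simp
  | add a b ha hb => simp only [map_add, ha, hb]
  | ι_mul x m hx =>
    have e : ExteriorAlgebra.map φ (CliffordAlgebra.ι 0 m) = CliffordAlgebra.ι 0 (φ m) :=
      ExteriorAlgebra.map_apply_ι φ m
    rw [map_mul, map_mul, map_mul, map_mul, e, hx, CliffordAlgebra.involute_ι,
      CliffordAlgebra.involute_ι, map_neg, e]

namespace SuperFun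

variable {I J : Type} [Fintype I] {V V' : Opens (I → ℝ)}

theorem invol_restrict (h : V' ≤ V) (F : SuperFun J V) :
    invol (restrict h F) = restrict h (invol F) := by
  induction F using SuperFun.induction with
  | tmul f θ => rfl
  | add F G hF hG => simp only [map_add, hF, hG]

theorem sgn_restrict (h : V' ≤ V) (k : ZMod 2) (F : SuperFun J V) :
    sgn k (restrict h F) = restrict h (sgn k F) := by
  rcases ZMod.eq_zero_or_eq_one_of_two k with rfl | rfl
  · simp
  · rw [sgn_one, sgn_one, invol_restrict]

theorem pderiv_restrict (h : V' ≤ V) (a : I ⊕ J) (F : SuperFun J V) :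
    pderiv a (restrict h F) = restrict h (pderiv a F) := by
  classical
  induction F using SuperFun.induction with
  | add F G hF hG => simp only [map_add, hF, hG]
  | tmul f θ =>
    rcases a with i | j
    · rw [restrict_tmul, pderiv_inl_tmul, pderiv_inl_tmul, restrict_tmul]
      congr 1
      ext x
      have h1 := SmoothFun.pderiv_comap (ContinuousLinearMap.id ℝ (I → ℝ)) h f i x
      refine h1.trans ?_
      exact (SmoothFun.pderiv_apply i f ⟨x, h x.2⟩).symm
    · rfl

theorem restrict_coord (h : V' ≤ V) (a : I ⊕ J) :
    restrict h (coord a : SuperFun J V) = coord a := by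
  rcases a with i | j
  · exact (restrict_tmul h _ _).trans rfl
  · change restrict h (tmul _ _) = _
    rw [restrict_tmul, map_one]
    rfl

end SuperFun

namespace SmoothFun

variable {I : Type} {V : Opens (I → ℝ)}

/-- The projection of the body of the cotangent bundle to the body of the base. -/
def cotangentProj (I : Type) : (I ⊕ I → ℝ) →L[ℝ] (I → ℝ) :=
  ContinuousLinearMap.pi fun i => ContinuousLinearMap.proj (R := ℝ) (.inl i)

theorem cotangentProj_mem (y : I ⊕ I → ℝ) (hy : y ∈ cotangentOpen V) : cotangentProj I y ∈ V := hy

variable [Fintype I]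

/-- Pull-back of smooth functions from the body of the base to that of the cotangent bundle. -/
noncomputable def cotangentPullback : SmoothFun V →ₐ[ℝ] SmoothFun (cotangentOpen V) :=
  comap (cotangentProj I) (cotangentProj I).contDiff cotangentProj_mem

theorem pderiv_inl_cotangentPullback (f : SmoothFun V) (i : I) :
    pderiv (.inl i) (cotangentPullback f) = cotangentPullback (pderiv i f) := by
  classical
  ext x
  refine (pderiv_comap (cotangentProj I) cotangentProj_mem f (.inl i) x).trans
    (Eq.trans (congrArg _ ?_) (pderiv_apply i f ⟨cotangentProj I x, x.2⟩).symm)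
  ext i'
  simp [cotangentProj, Pi.single_apply]

theorem pderiv_inr_cotangentPullback (f : SmoothFun V) (i : I) :
    pderiv (.inr i) (cotangentPullback f) = 0 := by
  classical
  ext x
  refine (pderiv_comap (cotangentProj I) cotangentProj_mem f (.inr i) x).trans
    (Eq.trans (congrArg _ ?_) (map_zero (fderiv ℝ (extendZero f.1) (cotangentProj I x))))
  ext i'
  simp [cotangentProj]

end SmoothFun

namespace CotFun

open SuperFun

variable {I J : Type} [Fintype I] {V V' : Opens (I → ℝ)}

theorem pullback_tmul (f : SmoothFun V) (θ : Grassmann J) :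
    pullback (tmul f θ) = tmul (SmoothFun.cotangentPullback f)
      (ExteriorAlgebra.map (Finsupp.lmapDomain ℝ ℝ Sum.inl) θ) :=
  rfl

theorem invol_pullback (f : SuperFun J V) : invol (pullback f) = pullback (invol f) := by
  induction f using SuperFun.induction with
  | add F G hF hG => simp only [map_add, hF, hG]
  | tmul f θ => rw [pullback_tmul, invol_tmul, invol_tmul, pullback_tmul, Grassmann.involute_map]

theorem sgn_pullback (k : ZMod 2) (f : SuperFun J V) :
    sgn k (pullback f) = pullback (sgn k f) := by
  rcases ZMod.eq_zero_or_eq_one_of_two k with rfl | rfl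
  · simp
  · rw [sgn_one, sgn_one, invol_pullback]

theorem pullback_mem_parity {k : ZMod 2} {f : SuperFun J V} (hf : f ∈ parity k) :
    pullback f ∈ parity k := by
  rw [mem_parity_iff, invol_pullback, mem_parity_iff.1 hf, map_smul]

theorem pderiv_pos_pullback (A : I ⊕ J) (f : SuperFun J V) :
    pderiv (pos A) (pullback f) = pullback (pderiv A f) := by
  classical
  induction f using SuperFun.induction with
  | add F G hF hG => simp only [map_add, hF, hG]
  | tmul f θ =>
    rcases A with i | j
    · rw [show pos (.inl i : I ⊕ J) = .inl (.inl i) from rfl, pullback_tmul, pderiv_inl_tmul,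
        pderiv_inl_tmul, pullback_tmul, SmoothFun.pderiv_inl_cotangentPullback]
    · rw [show pos (.inr j : I ⊕ J) = .inr (.inl j) from rfl, pullback_tmul, pderiv_inr_tmul, pderiv_inr_tmul, pullback_tmul,
        Grassmann.contractLeft_map]
      congr 4
      ext j'
      simp [Finsupp.single_apply]

theorem pderiv_mom_pullback (A : I ⊕ J) (f : SuperFun J V) :
    pderiv (mom A) (pullback f) = 0 := by
  classical
  induction f using SuperFun.induction with
  | add F G hF hG => simp only [map_add, hF, hG, add_zero]
  | tmul f θ =>
    rcases A with i | j
    · rw [show mom (.inl i : I ⊕ J) = .inl (.inr i) from rfl, pullback_tmul, pderiv_inl_tmul,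
        SmoothFun.pderiv_inr_cotangentPullback, zero_tmul]
    · rw [show mom (.inr j : I ⊕ J) = .inr (.inr j) from rfl, pullback_tmul, pderiv_inr_tmul, Grassmann.contractLeft_map]
      have : (Finsupp.lapply (R := ℝ) (M := ℝ) (Sum.inr j : J ⊕ J)) ∘ₗ
          Finsupp.lmapDomain ℝ ℝ (Sum.inl : J → J ⊕ J) = 0 := by
        ext j'
        simp
      rw [this]
      simp [tmul_zero]

/-- Restriction of functions on the cotangent bundle to the zero section. -/
noncomputable def zeroSection : CotFun J V →ₐ[ℝ] SuperFun J V :=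
  Algebra.TensorProduct.map
    (SmoothFun.comap (fun x => Sum.elim x 0)
      (contDiff_pi.2 fun a => by cases a <;> simp <;> fun_prop) fun _ hx => hx)
    (ExteriorAlgebra.map (Finsupp.lcomapDomain Sum.inl Sum.inl_injective))

@[simp] theorem zeroSection_pullback (f : SuperFun J V) : zeroSection (pullback f) = f := by
  induction f using SuperFun.induction with
  | add F G hF hG => simp only [map_add, hF, hG]
  | tmul f θ =>
    rw [pullback_tmul]
    change tmul _ (ExteriorAlgebra.map _ (ExteriorAlgebra.map _ θ)) = _
    rw [← AlgHom.comp_apply, ExteriorAlgebra.map_comp_map,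
      show (Finsupp.lcomapDomain Sum.inl Sum.inl_injective) ∘ₗ
        (Finsupp.lmapDomain ℝ ℝ Sum.inl : (J →₀ ℝ) →ₗ[ℝ] (J ⊕ J →₀ ℝ)) = LinearMap.id from
        LinearMap.ext fun v => Finsupp.comapDomain_mapDomain _ Sum.inl_injective v,
      ExteriorAlgebra.map_id]
    rfl

theorem pullback_injective : Function.Injective (pullback : SuperFun J V → CotFun J V) :=
  Function.LeftInverse.injective zeroSection_pullback

theorem restrict_pullback (h : V' ≤ V) (f : SuperFun J V) :
    restrict h (pullback f) = pullback (SuperFun.restrict h f) := by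
  induction f using SuperFun.induction with
  | add F G hF hG => simp only [map_add, hF, hG]
  | tmul f θ => rfl

theorem restrict_momentum (h : V' ≤ V) (A : I ⊕ J) :
    restrict h (momentum A : CotFun J V) = momentum A :=
  restrict_coord _ _

theorem momentum_mem_parity (A : I ⊕ J) :
    (momentum A : CotFun J V) ∈ parity (indexParity A) := by
  have h := coord_mem_parity (V := cotangentOpen V) (mom A)
  rwa [indexParity_mom] at h

variable [Fintype J]

theorem restrict_poisson (h : V' ≤ V) (F G : CotFun J V) :
    restrict h (poisson F G) = poisson (restrict h F) (restrict h G) := by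
  unfold restrict
  simp only [poisson_eq_sum, map_sum, map_sub, map_smul, map_mul, pderiv_restrict, sgn_restrict]

theorem poisson_pullback_right (F : CotFun J V) (f : SuperFun J V) :
    poisson F (pullback f) =
      ∑ A, sgn (indexParity A) (pderiv (mom A) F) * pullback (pderiv A f) := by
  simp [poisson_eq_sum, pderiv_pos_pullback, pderiv_mom_pullback]

theorem poisson_pullback_pullback (f g : SuperFun J V) :
    poisson (pullback f) (pullback g) = 0 := by
  simp [poisson_pullback_right, pderiv_mom_pullback]

theorem poisson_momentum_pullback (A : I ⊕ J) (f : SuperFun J V) :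
    poisson (momentum A) (pullback f) = pullback (pderiv A f) := by
  classical
  rw [poisson_pullback_right, Finset.sum_eq_single A]
  · simp [momentum, pderiv_coord]
  · intro B _ hB
    simp [momentum, pderiv_coord, mom_injective.eq_iff, hB]
  · simp

theorem poisson_pullback_mul_left (u : SuperFun J V) (F : CotFun J V) (f : SuperFun J V) :
    poisson (pullback u * F) (pullback f) = pullback u * poisson F (pullback f) := by
  induction f using homogeneous_induction with
  | add f g hf hg => simp only [map_add, poisson_add_right, hf, hg, mul_add]
  | hom k f hf =>
    rw [poisson_mul_left (pullback_mem_parity hf), poisson_pullback_pullback, zero_mul, add_zero]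

/-- The fibrewise linear functions `∑_A u^A(x) p_A`. -/
def fibreLinear : Submodule ℝ (CotFun J V) where
  carrier := {F | ∃ u : I ⊕ J → SuperFun J V, F = ∑ A, pullback (u A) * momentum A}
  add_mem' := by
    rintro _ _ ⟨u, rfl⟩ ⟨v, rfl⟩
    exact ⟨u + v, by simp [add_mul, Finset.sum_add_distrib]⟩
  zero_mem' := ⟨0, by simp⟩
  smul_mem' := by
    rintro r _ ⟨u, rfl⟩
    exact ⟨r • u, by simp [Finset.smul_sum]⟩

theorem pullback_mul_mem_fibreLinear (u : SuperFun J V) {F : CotFun J V}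
    (hF : F ∈ fibreLinear) : pullback u * F ∈ fibreLinear := by
  obtain ⟨v, rfl⟩ := hF
  exact ⟨fun A => u * v A, by simp only [Finset.mul_sum, map_mul, mul_assoc]⟩

theorem momentum_mem_fibreLinear (A : I ⊕ J) : (momentum A : CotFun J V) ∈ fibreLinear := by
  classical
  refine ⟨Pi.single A 1, ?_⟩
  rw [Finset.sum_eq_single A]
  · simp
  · intro B _ hB
    simp [hB]
  · simp

theorem poisson_fibreLinear_pullback (u : I ⊕ J → SuperFun J V) (f : SuperFun J V) :
    poisson (∑ A, pullback (u A) * momentum A) (pullback f) =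
      pullback (∑ A, u A * pderiv A f) := by
  rw [poisson_sum_left, map_sum]
  refine Finset.sum_congr rfl fun A _ => ?_
  rw [poisson_pullback_mul_left, poisson_momentum_pullback, map_mul]

theorem IsQuadratic.poisson_pullback_mem {F : CotFun J V} (hF : IsQuadratic F)
    (f : SuperFun J V) : poisson F (pullback f) ∈ fibreLinear := by
  obtain ⟨s, rfl⟩ := hF
  induction f using homogeneous_induction with
  | add f g hf hg => rw [map_add, poisson_add_right]; exact add_mem hf hg
  | hom k f hf =>
    rw [poisson_smul_left, poisson_sum_left]
    refine Submodule.smul_mem _ _ (sum_mem fun A _ => ?_)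
    rw [poisson_sum_left]
    refine sum_mem fun B _ => ?_
    rw [poisson_mul_left (pullback_mem_parity hf), poisson_momentum_pullback,
      poisson_pullback_mul_left, poisson_momentum_pullback, sgn_of_mem (momentum_mem_parity A),
      mul_assoc, mul_comm_of_mem (momentum_mem_parity B), sgn_pullback, mul_smul_comm, mul_assoc]
    exact add_mem (pullback_mul_mem_fibreLinear _ (pullback_mul_mem_fibreLinear _
      (momentum_mem_fibreLinear B))) (Submodule.smul_mem _ _ (pullback_mul_mem_fibreLinear _
      (pullback_mul_mem_fibreLinear _ (momentum_mem_fibreLinear A))))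

/-- The bilinear operation `{{F, f}, g}` on functions on the base, where `F` is fibrewise
quadratic. (Both brackets lower the fibre degree by one, so nothing is lost by restricting the
result to the zero section: see `IsQuadratic.pullback_derivedBracket`.) -/
noncomputable def derivedBracket (F : CotFun J V) :
    SuperFun J V →ₗ[ℝ] SuperFun J V →ₗ[ℝ] SuperFun J V :=
  LinearMap.mk₂ ℝ (fun f g => zeroSection (poisson (poisson F (pullback f)) (pullback g)))
    (fun f f' g => by simp only [map_add, poisson_add_right, poisson_add_left])
    (fun r f g => by simp only [map_smul, poisson_smul_right, poisson_smul_left])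
    (fun f g g' => by simp only [map_add, poisson_add_right])
    (fun r f g => by simp only [map_smul, poisson_smul_right])

theorem IsQuadratic.pullback_derivedBracket {F : CotFun J V} (hF : IsQuadratic F)
    (f g : SuperFun J V) :
    pullback (derivedBracket F f g) = poisson (poisson F (pullback f)) (pullback g) := by
  obtain ⟨u, hu⟩ := hF.poisson_pullback_mem f
  change pullback (zeroSection _) = _
  rw [hu, poisson_fibreLinear_pullback, zeroSection_pullback]

theorem IsQuadratic.restrict {F : CotFun J V} (hF : IsQuadratic F) (h : V' ≤ V) :
    IsQuadratic (restrict h F) := by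
  obtain ⟨s, rfl⟩ := hF
  refine ⟨fun A B => SuperFun.restrict h (s A B), ?_⟩
  simp only [map_smul, map_sum, map_mul, restrict_pullback, restrict_momentum]

theorem IsQuadratic.restrict_derivedBracket {F : CotFun J V} (hF : IsQuadratic F) (h : V' ≤ V)
    (f g : SuperFun J V) :
    SuperFun.restrict h (derivedBracket F f g) =
      derivedBracket (CotFun.restrict h F) (SuperFun.restrict h f) (SuperFun.restrict h g) := by
  apply pullback_injective
  rw [← restrict_pullback, hF.pullback_derivedBracket, (hF.restrict h).pullback_derivedBracket,
    restrict_poisson, restrict_poisson, restrict_pullback, restrict_pullback]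

namespace IsCotangentLift

variable {τ : SuperFun J V' ≃ₐ[ℝ] SuperFun J V}
  {Φ : CotFun J V' →ₐ[ℝ] CotFun J V}

theorem base_invol (hΦ : IsCotangentLift τ Φ) (f : SuperFun J V') :
    τ (SuperFun.invol f) = SuperFun.invol (τ f) := by
  apply pullback_injective
  rw [← hΦ.base, ← invol_pullback, hΦ.invol, hΦ.base, invol_pullback]

theorem map_sgn (hΦ : IsCotangentLift τ Φ) (k : ZMod 2) (F : CotFun J V') :
    Φ (sgn k F) = sgn k (Φ F) := by
  rcases ZMod.eq_zero_or_eq_one_of_two k with rfl | rfl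
  · simp
  · rw [sgn_one, sgn_one, hΦ.invol]

theorem base_sgn (hΦ : IsCotangentLift τ Φ) (k : ZMod 2) (f : SuperFun J V') :
    τ (sgn k f) = sgn k (τ f) := by
  rcases ZMod.eq_zero_or_eq_one_of_two k with rfl | rfl
  · simp
  · rw [sgn_one, sgn_one, hΦ.base_invol]

/-- The chain rule `∂/∂x̄^A = ∑_B ∂x^B/∂x̄^A ∂/∂x^B`. -/
theorem base_pderiv (hΦ : IsCotangentLift τ Φ) (A : I ⊕ J) (f : SuperFun J V') :
    τ (SuperFun.pderiv A f) =
      ∑ B, τ (SuperFun.pderiv A (τ.symm (coord B))) * SuperFun.pderiv B (τ f) := by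
  have hsymm : ∀ F, τ.symm (SuperFun.invol F) = SuperFun.invol (τ.symm F) := fun F => by
    rw [AlgEquiv.symm_apply_eq, hΦ.base_invol, AlgEquiv.apply_symm_apply]
  have hsymm' : ∀ k F, τ.symm (sgn k F) = sgn k (τ.symm F) := fun k F => by
    rw [AlgEquiv.symm_apply_eq, hΦ.base_sgn, AlgEquiv.apply_symm_apply]
  have hD : IsSuperDerivation (indexParity A)
      (τ.toLinearMap ∘ₗ SuperFun.pderiv A ∘ₗ τ.symm.toLinearMap) :=
    { map_invol := fun F => by
        simp only [LinearMap.comp_apply, AlgEquiv.toLinearMap_apply]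
        rw [hsymm, (isSuperDerivation_pderiv A).map_invol, map_smul, hΦ.base_invol]
      leibniz := fun F G => by
        simp only [LinearMap.comp_apply, AlgEquiv.toLinearMap_apply]
        rw [map_mul, pderiv_mul, map_add, map_mul, map_mul, AlgEquiv.apply_symm_apply,
          hΦ.base_sgn, AlgEquiv.apply_symm_apply] }
  have h := hD.apply_eq_sum (τ f)
  simpa only [LinearMap.comp_apply, AlgEquiv.toLinearMap_apply, AlgEquiv.symm_apply_apply] using h

theorem map_poisson_momentum (hΦ : IsCotangentLift τ Φ) (A : I ⊕ J) (f : SuperFun J V') :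
    Φ (poisson (CotFun.momentum A) (pullback f)) =
      poisson (Φ (CotFun.momentum A)) (Φ (pullback f)) := by
  rw [poisson_momentum_pullback, hΦ.base, hΦ.base_pderiv, hΦ.momentum, hΦ.base,
    poisson_fibreLinear_pullback]

theorem map_poisson_pullback_mul (hΦ : IsCotangentLift τ Φ) (u : SuperFun J V')
    {F : CotFun J V'} {f : SuperFun J V'}
    (hF : Φ (poisson F (pullback f)) = poisson (Φ F) (Φ (pullback f))) :
    Φ (poisson (pullback u * F) (pullback f)) = poisson (Φ (pullback u * F)) (Φ (pullback f)) := by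
  rw [map_mul Φ, hΦ.base, hΦ.base, poisson_pullback_mul_left, poisson_pullback_mul_left, map_mul,
    hF, hΦ.base, hΦ.base]

theorem map_poisson_of_mem_fibreLinear (hΦ : IsCotangentLift τ Φ) {F : CotFun J V'}
    (hF : F ∈ fibreLinear) (f : SuperFun J V') :
    Φ (poisson F (pullback f)) = poisson (Φ F) (Φ (pullback f)) := by
  obtain ⟨u, rfl⟩ := hF
  rw [poisson_sum_left, map_sum, map_sum, poisson_sum_left]
  exact Finset.sum_congr rfl fun A _ =>
    hΦ.map_poisson_pullback_mul _ (hΦ.map_poisson_momentum A f)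

/-- The changes of coordinates of the cotangent bundle preserve the Poisson brackets of fibrewise
quadratic functions with functions on the base. By the Leibniz rule this reduces to the brackets of
the momenta, where it is the chain rule. -/
theorem map_poisson_of_isQuadratic (hΦ : IsCotangentLift τ Φ) {F : CotFun J V'}
    (hF : IsQuadratic F) (f : SuperFun J V') :
    Φ (poisson F (pullback f)) = poisson (Φ F) (Φ (pullback f)) := by
  induction f using homogeneous_induction with
  | add f g hf hg => simp only [map_add, poisson_add_right, hf, hg]
  | hom k f hf =>
    obtain ⟨s, rfl⟩ := hF
    have hf' : Φ (pullback f) ∈ parity k := by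
      rw [mem_parity_iff, ← hΦ.invol, mem_parity_iff.1 (pullback_mem_parity hf), map_smul]
    simp only [poisson_smul_left, poisson_sum_left, map_smul, map_sum]
    congr 1
    refine Finset.sum_congr rfl fun A _ => Finset.sum_congr rfl fun B _ => ?_
    rw [poisson_mul_left (pullback_mem_parity hf), map_add, map_mul Φ,
      map_mul Φ (poisson _ _), map_mul Φ _ (CotFun.momentum A), poisson_mul_left hf', hΦ.map_sgn,
      hΦ.map_poisson_momentum, hΦ.map_poisson_pullback_mul _ (hΦ.map_poisson_momentum B f)]

theorem map_derivedBracket (hΦ : IsCotangentLift τ Φ) {F : CotFun J V'} (hF : IsQuadratic F)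
    (hF' : IsQuadratic (Φ F)) (f g : SuperFun J V') :
    τ (derivedBracket F f g) = derivedBracket (Φ F) (τ f) (τ g) := by
  apply pullback_injective
  rw [← hΦ.base, hF.pullback_derivedBracket, hF'.pullback_derivedBracket,
    hΦ.map_poisson_of_mem_fibreLinear (hF.poisson_pullback_mem f),
    hΦ.map_poisson_of_isQuadratic hF, hΦ.base, hΦ.base]

end IsCotangentLift

end CotFun

/-! ### The derived bracket of an odd Jacobi structure in a chart -/

/-- An odd Jacobi structure on a superdomain, in natural coordinates: `S` is the almost Schouten
structure and `Q` is the action of the homological vector field on functions, so that its principal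
symbol is `∑_A Q(x^A) p_A`. -/
structure IsLocalOddJacobi {I J : Type} [Fintype I] [Fintype J] {V : Opens (I → ℝ)}
    (S : CotFun J V) (Q : SuperFun J V →ₗ[ℝ] SuperFun J V) : Prop where
  odd : S ∈ SuperFun.parity 1
  quadratic : CotFun.IsQuadratic S
  derivation : SuperFun.IsSuperDerivation 1 Q
  homological : ∀ f, Q (Q f) = 0
  invariance : CotFun.poisson
    (∑ A, CotFun.pullback (Q (SuperFun.coord A)) * CotFun.momentum A) S = 0
  compatibility : CotFun.poisson S S =
    (-2 : ℝ) • ((∑ A, CotFun.pullback (Q (SuperFun.coord A)) * CotFun.momentum A) * S)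

namespace IsLocalOddJacobi

open SuperFun CotFun

variable {I J : Type} [Fintype I] [Fintype J] {V : Opens (I → ℝ)} {S : CotFun J V}
  {Q : SuperFun J V →ₗ[ℝ] SuperFun J V} {i j k : ZMod 2} {f g h : SuperFun J V}

theorem symbol_mem_parity (hQ : IsSuperDerivation 1 Q) :
    ∑ A, pullback (Q (coord A)) * momentum A ∈ (parity 1 : Submodule ℝ (CotFun J V)) :=
  sum_mem fun A _ => by
    have h := mul_mem_parity (pullback_mem_parity (hQ.mem_parity (coord_mem_parity A)))
      (momentum_mem_parity A)
    rwa [show indexParity A + 1 + indexParity A = 1 by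
      rw [add_right_comm, CharTwo.add_self_eq_zero, zero_add]] at h

/-- The Poisson bracket with the principal symbol of a vector field is its action on functions. -/
theorem poisson_symbol_pullback (hQ : IsSuperDerivation 1 Q) (f : SuperFun J V) :
    poisson (∑ A, pullback (Q (coord A)) * momentum A) (pullback f) = pullback (Q f) := by
  rw [poisson_fibreLinear_pullback, ← hQ.apply_eq_sum]

theorem poisson_mem (H : IsLocalOddJacobi S Q) (hf : f ∈ parity i) :
    poisson S (pullback f) ∈ parity (1 + i) :=
  poisson_mem_parity H.odd (pullback_mem_parity hf)

theorem derivedBracket_mem (H : IsLocalOddJacobi S Q) (hf : f ∈ parity i) (hg : g ∈ parity j) :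
    derivedBracket S f g ∈ parity (i + j + 1) := by
  rw [mem_parity_iff]
  apply pullback_injective
  rw [← invol_pullback, map_smul, H.quadratic.pullback_derivedBracket,
    mem_parity_iff.1 (poisson_mem_parity (H.poisson_mem hf) (pullback_mem_parity hg)),
    show 1 + i + j = i + j + 1 by ring]

/-- The derived bracket is graded symmetric, because functions on the base Poisson commute. -/
theorem derivedBracket_symm (H : IsLocalOddJacobi S Q) (hf : f ∈ parity i) (hg : g ∈ parity j) :
    derivedBracket S f g = paritySign (i * j) • derivedBracket S g f := by
  apply pullback_injective
  have hJ := poisson_jacobi H.odd (pullback_mem_parity hf) (pullback g)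
  rw [poisson_pullback_pullback, poisson_antisymm (H.poisson_mem hg),
    sgn_of_mem (pullback_mem_parity hf), poisson_smul_right, ← H.quadratic.pullback_derivedBracket,
    ← H.quadratic.pullback_derivedBracket, ← poissonLinear_apply, map_zero, smul_neg, smul_smul,
    ← paritySign_add, eq_comm, ← sub_eq_add_neg, sub_eq_zero] at hJ
  rw [hJ, map_smul, show 1 * i + (1 + j) * i = i * j by
    linear_combination i * ZMod.one_add_one_of_two]

theorem derivedBracket_mul (H : IsLocalOddJacobi S Q) (hf : f ∈ parity i) (g h : SuperFun J V) :
    derivedBracket S f (g * h) =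
      derivedBracket S f g * h + sgn (i + 1) g * derivedBracket S f h := by
  apply pullback_injective
  rw [map_add, map_mul pullback, map_mul pullback, ← sgn_pullback]
  simp only [H.quadratic.pullback_derivedBracket]
  rw [map_mul pullback, poisson_mul_right (H.poisson_mem hf), add_comm 1 i]

/-- The derived bracket is invariant under the homological vector field, as `{𝒬, S} = 0`. -/
theorem apply_derivedBracket (H : IsLocalOddJacobi S Q) (hf : f ∈ parity i) (g : SuperFun J V) :
    Q (derivedBracket S f g) =
      -derivedBracket S (Q f) g - paritySign i • derivedBracket S f (Q g) := by
  apply pullback_injective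
  have hs := symbol_mem_parity H.derivation
  have h1 := poisson_jacobi hs H.odd (pullback f)
  have h2 := poisson_jacobi hs (H.poisson_mem hf) (pullback g)
  rw [H.invariance, ← poissonLinear_apply 0, map_zero, LinearMap.zero_apply, zero_add,
    poisson_symbol_pullback H.derivation, one_mul, paritySign_one, neg_smul, one_smul] at h1
  rw [h1, poisson_neg_left, poisson_symbol_pullback H.derivation] at h2
  simp only [← H.quadratic.pullback_derivedBracket] at h2
  rw [poisson_symbol_pullback H.derivation] at h2
  rw [h2, map_sub, map_neg, map_smul, one_mul, paritySign_add, paritySign_one]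
  module

/-- The failure of the Jacobi identity for the derived bracket: three brackets of
`{S, S} = -2 𝒬 S` with functions on the base. -/
theorem derivedBracket_jacobi (H : IsLocalOddJacobi S Q) (hf : f ∈ parity i) (hg : g ∈ parity j)
    (hh : h ∈ parity k) :
    derivedBracket S (derivedBracket S f g) h =
      paritySign (1 + i) • (derivedBracket S f (derivedBracket S g h) -
        paritySign ((1 + i) * (1 + j)) • derivedBracket S g (derivedBracket S f h)) -
      (paritySign (k * (i + j + 1)) • (Q h * derivedBracket S f g) +
        paritySign (j * (1 + i)) • (Q g * derivedBracket S f h) +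
        paritySign i • (Q f * derivedBracket S g h)) := by
  apply pullback_injective
  set q : CotFun J V := ∑ A, pullback (Q (coord A)) * momentum A with hq
  have hqf : ∀ f, poisson q (pullback f) = pullback (Q f) :=
    poisson_symbol_pullback H.derivation
  have hT := H.quadratic.pullback_derivedBracket
  set a := poisson S (pullback f) with ha
  set b := poisson S (pullback g) with hb
  have ha1 : a ∈ parity (1 + i) := H.poisson_mem hf
  have hb1 : b ∈ parity (1 + j) := H.poisson_mem hg
  have hTfg := pullback_mem_parity (H.derivedBracket_mem hf hg)
  -- the bracket of `{S, S} = -2 𝒬 S` with `f`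
  have e1 : poisson S a = -(q * a + paritySign i • (pullback (Q f) * S)) := by
    have h1 := poisson_jacobi H.odd H.odd (pullback f)
    rw [H.compatibility, ← hq, poisson_smul_left, poisson_mul_left (pullback_mem_parity hf),
      hqf, sgn_of_mem H.odd, mul_one, mul_one, paritySign_one, mul_smul_comm, ← ha] at h1
    have h2 : (2 : ℝ) • poisson S a =
        (2 : ℝ) • -(q * a + paritySign i • (pullback (Q f) * S)) := by
      linear_combination (norm := module) h1
    exact smul_right_injective _ (two_ne_zero (α := ℝ)) h2
  -- and with `g`
  have e2 : poisson S (pullback (derivedBracket S f g)) - paritySign (1 + i) • poisson a b =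
      -(q * pullback (derivedBracket S f g) + paritySign (j * (1 + i)) • (pullback (Q g) * a) +
        paritySign i • (pullback (Q f) * b)) := by
    have h1 := poisson_jacobi H.odd ha1 (pullback g)
    rw [← hT, e1, poisson_neg_left, poisson_add_left, poisson_smul_left,
      poisson_mul_left (pullback_mem_parity hg), poisson_pullback_mul_left, hqf, ← hT,
      sgn_of_mem ha1, ← hb, one_mul, mul_smul_comm] at h1
    linear_combination (norm := module) h1
  -- and with `h`
  have e3 := congrArg (fun F => poisson F (pullback h)) e2
  have h3 := poisson_jacobi ha1 hb1 (pullback h)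
  simp only [sub_eq_add_neg, poisson_neg_left, poisson_add_left, poisson_smul_left] at e3
  rw [← hT, poisson_mul_left (pullback_mem_parity hh), poisson_pullback_mul_left,
    poisson_pullback_mul_left, hqf, ← hT, ← hT, poisson_pullback_pullback, mul_zero, zero_add,
    sgn_of_mem hTfg, mul_smul_comm] at e3
  rw [← hT, ← hT, ← hT, ← hT] at h3
  simp only [map_sub, map_add, map_smul, map_mul]
  linear_combination (norm := module) e3 - paritySign (1 + i) • h3

end IsLocalOddJacobi

/-! ### The symmetric form of the odd Jacobi bracket -/

namespace IsLocalOddJacobi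

open SuperFun CotFun

variable {I J : Type} [Fintype I] [Fintype J] {V : Opens (I → ℝ)} {S : CotFun J V}
  {Q : SuperFun J V →ₗ[ℝ] SuperFun J V} {i j k : ZMod 2} {f g h : SuperFun J V}

/-- The bilinear operation `K(f, g) = {{S, f}, g} - Q(fg)`. It is the odd Jacobi bracket up to the
sign `(-1)^{f̃ + 1}`, which makes it graded symmetric. -/
noncomputable def symmetricBracket (S : CotFun J V) (Q : SuperFun J V →ₗ[ℝ] SuperFun J V) :
    SuperFun J V →ₗ[ℝ] SuperFun J V →ₗ[ℝ] SuperFun J V :=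
  derivedBracket S - (LinearMap.mul ℝ (SuperFun J V)).compr₂ Q

theorem symmetricBracket_apply (f g : SuperFun J V) :
    symmetricBracket S Q f g = derivedBracket S f g - Q (f * g) := rfl

theorem symmetricBracket_mem (H : IsLocalOddJacobi S Q) (hf : f ∈ parity i) (hg : g ∈ parity j) :
    symmetricBracket S Q f g ∈ parity (i + j + 1) :=
  sub_mem (H.derivedBracket_mem hf hg) (H.derivation.mem_parity (mul_mem_parity hf hg))

theorem symmetricBracket_symm (H : IsLocalOddJacobi S Q) (hf : f ∈ parity i) (hg : g ∈ parity j) :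
    symmetricBracket S Q f g = paritySign (i * j) • symmetricBracket S Q g f := by
  rw [symmetricBracket_apply, symmetricBracket_apply, H.derivedBracket_symm hf hg,
    supercomm hf hg, map_smul, smul_sub]

theorem symmetricBracket_mul (H : IsLocalOddJacobi S Q) (hf : f ∈ parity i) (hg : g ∈ parity j)
    (h : SuperFun J V) :
    symmetricBracket S Q f (g * h) = symmetricBracket S Q f g * h +
      paritySign ((i + 1) * j) • (g * symmetricBracket S Q f h) -
      symmetricBracket S Q f 1 * g * h := by
  have h1 : derivedBracket S f 1 = 0 := by
    have := H.derivedBracket_mul hf 1 1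
    rw [mul_one, mul_one, map_one (sgn (i + 1)), one_mul] at this
    exact left_eq_add.1 this
  have hd := H.derivation.leibniz
  have hc : g * Q f = paritySign (j * (i + 1)) • (Q f * g) :=
    supercomm hg (H.derivation.mem_parity hf)
  have hc' : g * f = paritySign (j * i) • (f * g) := supercomm hg hf
  simp only [symmetricBracket_apply, h1, H.derivedBracket_mul hf, sgn_of_mem hg, mul_one, zero_sub,
    hd, sgn_of_mem hf, mul_add, mul_sub, sub_mul, add_mul, neg_mul, smul_mul_assoc, mul_smul_comm,
    smul_sub, smul_add]
  rw [← mul_assoc g, ← mul_assoc g, hc, hc', ← mul_assoc f g]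
  simp only [smul_mul_assoc, mul_assoc]
  rcases ZMod.eq_zero_or_eq_one_of_two i with rfl | rfl <;>
  rcases ZMod.eq_zero_or_eq_one_of_two j with rfl | rfl <;>
  simp only [paritySign_zero, paritySign_one, mul_zero, mul_one, zero_add,
    add_zero, ZMod.one_add_one_of_two] <;> module

theorem derivedBracket_mul_left (H : IsLocalOddJacobi S Q) (hf : f ∈ parity i)
    (hg : g ∈ parity j) (hh : h ∈ parity k) :
    derivedBracket S (f * g) h = paritySign i • (f * derivedBracket S g h) +
      paritySign (i * j + j) • (g * derivedBracket S f h) := by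
  have hc := supercomm (H.derivedBracket_mem hf hh) hg
  rw [H.derivedBracket_symm (mul_mem_parity hf hg) hh, H.derivedBracket_mul hh,
    H.derivedBracket_symm hh hf, H.derivedBracket_symm hh hg, sgn_of_mem hf, smul_mul_assoc, hc,
    smul_mul_assoc, mul_smul_comm]
  rcases ZMod.eq_zero_or_eq_one_of_two i with rfl | rfl <;>
  rcases ZMod.eq_zero_or_eq_one_of_two j with rfl | rfl <;>
  rcases ZMod.eq_zero_or_eq_one_of_two k with rfl | rfl <;>
  simp only [paritySign_zero, paritySign_one, mul_zero, mul_one, zero_add,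
    add_zero, ZMod.one_add_one_of_two] <;> module

/-- The iterated bracket `K(K(f, g), h)`, expanded into monomials. -/
theorem symmetricBracket_symmetricBracket (H : IsLocalOddJacobi S Q) (hf : f ∈ parity i)
    (hg : g ∈ parity j) (hh : h ∈ parity k) :
    symmetricBracket S Q (symmetricBracket S Q f g) h =
      derivedBracket S (derivedBracket S f g) h
      + paritySign i • (Q f * derivedBracket S g h)
      - paritySign (i * j) • (g * derivedBracket S (Q f) h)
      - f * derivedBracket S (Q g) h
      - paritySign (i * j + i + j + 1 + i) • (Q g * derivedBracket S f h)
      + paritySign (k * (i + j)) • (h * derivedBracket S (Q f) g)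
      + paritySign (i * j + k * (i + j)) • (h * derivedBracket S (Q g) f)
      - paritySign ((i + j + 1) * k) • (Q h * derivedBracket S f g)
      + paritySign (i + j + 1 + (i + 1) * j) • (g * (Q f * Q h))
      + paritySign (j + 1) • (f * (Q g * Q h)) := by
  have hQf := H.derivation.mem_parity hf
  have hQg := H.derivation.mem_parity hg
  have hQh := H.derivation.mem_parity hh
  have hd := H.derivation.leibniz
  have e1 : derivedBracket S (Q (f * g)) h =
      paritySign (i + 1) • (Q f * derivedBracket S g h) +
      paritySign ((i + 1) * j + j) • (g * derivedBracket S (Q f) h) +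
      paritySign i • (paritySign i • (f * derivedBracket S (Q g) h) +
        paritySign (i * (j + 1) + (j + 1)) • (Q g * derivedBracket S f h)) := by
    rw [hd, sgn_of_mem hf, one_mul, map_add, LinearMap.add_apply, smul_mul_assoc, map_smul,
      LinearMap.smul_apply, H.derivedBracket_mul_left hQf hg hh,
      H.derivedBracket_mul_left hf hQg hh]
  have e2 : Q (derivedBracket S f g * h) =
      -(paritySign ((i + 1 + j + 1) * k) • (h * derivedBracket S (Q f) g)) -
      paritySign i • paritySign (i * (j + 1)) • paritySign ((j + 1 + i + 1) * k) •
        (h * derivedBracket S (Q g) f) +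
      paritySign (i + j + 1) • paritySign ((i + j + 1) * (k + 1)) •
        (Q h * derivedBracket S f g) := by
    rw [hd, H.apply_derivedBracket hf, H.derivedBracket_symm hf hQg,
      sgn_of_mem (H.derivedBracket_mem hf hg), one_mul, sub_mul, neg_mul, smul_mul_assoc,
      smul_mul_assoc, smul_mul_assoc, supercomm (H.derivedBracket_mem hQf hg) hh,
      supercomm (H.derivedBracket_mem hQg hf) hh, supercomm (H.derivedBracket_mem hf hg) hQh]
  have e3 : Q (Q (f * g) * h) = paritySign (i + j + 1) •
      (paritySign ((i + 1) * j) • (g * (Q f * Q h)) + paritySign i • (f * (Q g * Q h))) := by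
    rw [hd, H.homological, zero_mul, zero_add,
      sgn_of_mem (H.derivation.mem_parity (mul_mem_parity hf hg)), one_mul, hd, sgn_of_mem hf,
      one_mul, supercomm hQf hg]
    simp only [smul_mul_assoc, add_mul, mul_assoc]
  rw [symmetricBracket_apply (symmetricBracket S Q f g) h, symmetricBracket_apply f g, map_sub,
    LinearMap.sub_apply, e1, sub_mul, map_sub, e2, e3]
  rcases ZMod.eq_zero_or_eq_one_of_two i with rfl | rfl <;>
  rcases ZMod.eq_zero_or_eq_one_of_two j with rfl | rfl <;>
  rcases ZMod.eq_zero_or_eq_one_of_two k with rfl | rfl <;>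
  simp only [paritySign_zero, paritySign_one, mul_zero, mul_one, zero_add,
    add_zero, ZMod.one_add_one_of_two] <;> module

/-- The Jacobi identity of the symmetric bracket. In the cyclic sum of the expansions the Jacobiator
of the derived bracket is replaced by terms `Q(f) {{S, g}, h}`, which cancel the others of this
form. -/
theorem symmetricBracket_jacobi (H : IsLocalOddJacobi S Q) (hf : f ∈ parity i)
    (hg : g ∈ parity j) (hh : h ∈ parity k) :
    paritySign (i * k) • symmetricBracket S Q (symmetricBracket S Q f g) h +
      paritySign (j * i) • symmetricBracket S Q (symmetricBracket S Q g h) f +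
      paritySign (k * j) • symmetricBracket S Q (symmetricBracket S Q h f) g = 0 := by
  have hJ := H.derivedBracket_jacobi hf hg hh
  rw [H.derivedBracket_symm hf (H.derivedBracket_mem hg hh), H.derivedBracket_symm hf hh,
    map_smul, H.derivedBracket_symm hg (H.derivedBracket_mem hh hf)] at hJ
  rw [H.symmetricBracket_symmetricBracket hf hg hh, H.symmetricBracket_symmetricBracket hg hh hf,
    H.symmetricBracket_symmetricBracket hh hf hg, hJ, H.derivedBracket_symm hf hh,
    H.derivedBracket_symm hg hf, H.derivedBracket_symm hh hg,
    supercomm (H.derivation.mem_parity hg) (H.derivation.mem_parity hf),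
    supercomm (H.derivation.mem_parity hh) (H.derivation.mem_parity hg),
    supercomm (H.derivation.mem_parity hh) (H.derivation.mem_parity hf)]
  simp only [mul_smul_comm]
  rcases ZMod.eq_zero_or_eq_one_of_two i with rfl | rfl <;>
  rcases ZMod.eq_zero_or_eq_one_of_two j with rfl | rfl <;>
  rcases ZMod.eq_zero_or_eq_one_of_two k with rfl | rfl <;>
  simp only [paritySign_zero, paritySign_one, mul_zero, mul_one, zero_add,
    add_zero, ZMod.one_add_one_of_two] <;> module

end IsLocalOddJacobi

/-! ### Gluing over a supermanifold -/

namespace SuperSpace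

variable {M : SuperSpace.{u}} {U : Opens M.space}

theorem exists_eq_add (f : M.sec U) :
    ∃ f₀ ∈ M.parity U 0, ∃ f₁ ∈ M.parity U 1, f = f₀ + f₁ := by
  have h : f ∈ ⨆ k, M.parity U k := by
    rw [(M.internal U).submodule_iSup_eq_top]; trivial
  induction h using Submodule.iSup_induction' with
  | mem k f hf =>
    rcases ZMod.eq_zero_or_eq_one_of_two k with rfl | rfl
    · exact ⟨f, hf, 0, zero_mem _, (add_zero f).symm⟩
    · exact ⟨0, zero_mem _, f, hf, (zero_add f).symm⟩
  | zero => exact ⟨0, zero_mem _, 0, zero_mem _, (add_zero 0).symm⟩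
  | add f g _ _ hf hg =>
    obtain ⟨f₀, hf₀, f₁, hf₁, rfl⟩ := hf
    obtain ⟨g₀, hg₀, g₁, hg₁, rfl⟩ := hg
    exact ⟨f₀ + g₀, add_mem hf₀ hg₀, f₁ + g₁, add_mem hf₁ hg₁, add_add_add_comm _ _ _ _⟩

/-- Additive statements about sections need only be checked on homogeneous ones. -/
theorem homogeneous_induction {P : M.sec U → Prop} (f : M.sec U)
    (hom : ∀ k, ∀ f ∈ M.parity U k, P f) (add : ∀ f g, P f → P g → P (f + g)) : P f := by
  obtain ⟨f₀, hf₀, f₁, hf₁, rfl⟩ := exists_eq_add f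
  exact add _ _ (hom 0 _ hf₀) (hom 1 _ hf₁)

/-- The parity involution `f ↦ (-1)^{f̃} f` of sections. -/
noncomputable def invol (M : SuperSpace.{u}) (U : Opens M.space) : M.sec U →ₗ[ℝ] M.sec U :=
  DirectSum.toModule ℝ (ZMod 2) _ (fun k => paritySign k • (M.parity U k).subtype) ∘ₗ
    (LinearEquiv.ofBijective (DirectSum.coeLinearMap (M.parity U)) (M.internal U)).symm.toLinearMap

theorem invol_of_mem {k : ZMod 2} {f : M.sec U} (hf : f ∈ M.parity U k) :
    M.invol U f = paritySign k • f := by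
  have h : (LinearEquiv.ofBijective (DirectSum.coeLinearMap (M.parity U)) (M.internal U)).symm f =
      DirectSum.lof ℝ (ZMod 2) (fun k => M.parity U k) k ⟨f, hf⟩ := by
    rw [LinearEquiv.symm_apply_eq]
    exact (DirectSum.coeLinearMap_lof (M.parity U) k ⟨f, hf⟩).symm
  rw [invol, LinearMap.comp_apply, LinearEquiv.coe_coe, h, DirectSum.toModule_lof]
  rfl

theorem mem_parity_of_invol {k : ZMod 2} {f : M.sec U} (hf : M.invol U f = paritySign k • f) :
    f ∈ M.parity U k := by
  obtain ⟨f₀, hf₀, f₁, hf₁, rfl⟩ := exists_eq_add f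
  rw [map_add, invol_of_mem hf₀, invol_of_mem hf₁] at hf
  rcases ZMod.eq_zero_or_eq_one_of_two k with rfl | rfl
  · have h : f₁ = 0 := by
      simp only [paritySign_zero, paritySign_one] at hf
      linear_combination (norm := module) (-1 / 2 : ℝ) • hf
    rwa [h, add_zero]
  · have h : f₀ = 0 := by
      simp only [paritySign_zero, paritySign_one] at hf
      linear_combination (norm := module) (1 / 2 : ℝ) • hf
    rwa [h, zero_add]

theorem res_res {U V W : Opens M.space} (h : U ≤ V) (h' : V ≤ W) (f : M.sec W) :
    M.res h (M.res h' f) = M.res (h.trans h') f := by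
  change (M.sheaf.presheaf.map _ ≫ M.sheaf.presheaf.map _).hom f = _
  rw [← Functor.map_comp]
  rfl

end SuperSpace

namespace SuperChart

variable {p q : ℕ} {M : SuperSpace.{u}}

/-- The coordinate expression of global functions, as a homomorphism. -/
noncomputable def readHom (c : SuperChart M p q) : M.Fun →ₐ[ℝ] SuperFun (Fin q) c.img :=
  (c.coordIso : M.sec c.dom →ₐ[ℝ] SuperFun (Fin q) c.img).comp (M.res le_top)

theorem read_eq (c : SuperChart M p q) (f : M.Fun) : c.read f = c.readHom f := rfl

theorem iso_invol (c : SuperChart M p q) (W : Opens M.space) (hW) (f : M.sec W) :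
    c.iso W hW (M.invol W f) = SuperFun.invol (c.iso W hW f) := by
  induction f using SuperSpace.homogeneous_induction with
  | add f g hf hg => simp only [map_add, hf, hg]
  | hom k f hf =>
    rw [SuperSpace.invol_of_mem hf, map_smul, SuperFun.mem_parity_iff.1 (c.iso_parity W hW k f hf)]

theorem symm_mem_parity (c : SuperChart M p q) {k : ZMod 2} {F : SuperFun (Fin q) c.img}
    (hF : F ∈ SuperFun.parity k) : c.coordIso.symm F ∈ M.parity c.dom k := by
  apply SuperSpace.mem_parity_of_invol
  apply c.coordIso.injective
  have h := c.iso_invol c.dom subset_rfl (c.coordIso.symm F)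
  refine h.trans ?_
  change SuperFun.invol (c.coordIso (c.coordIso.symm F)) = _
  rw [map_smul, AlgEquiv.apply_symm_apply]
  exact hF

theorem readHom_mem_parity (c : SuperChart M p q) {k : ZMod 2} {f : M.Fun}
    (hf : f ∈ M.parity ⊤ k) : c.readHom f ∈ SuperFun.parity k :=
  c.iso_parity _ _ k _ (M.map_parity _ k f hf)

theorem readHom_invol (c : SuperChart M p q) (f : M.Fun) :
    c.readHom (M.invol ⊤ f) = SuperFun.invol (c.readHom f) := by
  induction f using SuperSpace.homogeneous_induction with
  | add f g hf hg => simp only [map_add, hf, hg]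
  | hom k f hf =>
    rw [SuperSpace.invol_of_mem hf, map_smul,
      SuperFun.mem_parity_iff.1 (c.readHom_mem_parity hf)]

/-- The coordinate expressions of a global function are related by the changes of coordinates. -/
theorem transition_restrict_read (c c' : SuperChart M p q) (f : M.Fun) :
    c.transition c' (SuperFun.restrict (c.overlap'_le c') (c'.readHom f)) =
      SuperFun.restrict (c.overlap_le c') (c.readHom f) := by
  have h := c.iso_res c.dom (c.dom ⊓ c'.dom) subset_rfl (fun _ hx => hx.1) inf_le_left
    (M.res le_top f)
  have h' := c'.iso_res c'.dom (c.dom ⊓ c'.dom) subset_rfl (fun _ hx => hx.2) inf_le_right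
    (M.res le_top f)
  rw [SuperSpace.res_res] at h h'
  refine Eq.trans ?_ h
  change c.iso _ _ ((c'.iso _ _).symm (SuperFun.restrict _ _)) = _
  congr 1
  rw [AlgEquiv.symm_apply_eq]
  exact h'.symm

end SuperChart

namespace Supermanifold

variable {p q : ℕ} {M : Supermanifold.{u} p q}

theorem le_iSup_dom : (⊤ : Opens M.space) ≤
    iSup fun c : SuperChart M.toSuperSpace p q => c.dom := fun x _ => by
  obtain ⟨c, hc⟩ := M.exists_chart x
  exact Opens.mem_iSup.2 ⟨c, hc⟩

/-- A global function is determined by its coordinate expressions. -/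
theorem ext_read {f g : M.Fun}
    (h : ∀ c : SuperChart M.toSuperSpace p q, c.readHom f = c.readHom g) : f = g :=
  M.sheaf.eq_of_locally_eq' (fun c : SuperChart M.toSuperSpace p q => c.dom) ⊤
    (fun _ => homOfLE le_top) le_iSup_dom f g fun c => c.coordIso.injective (h c)

theorem mem_parity_iff {k : ZMod 2} {f : M.Fun} : f ∈ M.parity ⊤ k ↔
    ∀ c : SuperChart M.toSuperSpace p q, c.readHom f ∈ SuperFun.parity k := by
  refine ⟨fun h c => c.readHom_mem_parity h, fun h => SuperSpace.mem_parity_of_invol ?_⟩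
  refine ext_read fun c => ?_
  rw [c.readHom_invol, map_smul, SuperFun.mem_parity_iff.1 (h c)]

/-- Coordinate expressions that are related by the changes of coordinates define a global
function. -/
theorem exists_read_eq (F : ∀ c : SuperChart M.toSuperSpace p q, SuperFun (Fin q) c.img)
    (hF : ∀ c c', c.transition c' (SuperFun.restrict (c.overlap'_le c') (F c')) =
      SuperFun.restrict (c.overlap_le c') (F c)) :
    ∃ f : M.Fun, ∀ c, c.readHom f = F c := by
  have hcompat : TopCat.Presheaf.IsCompatible M.sheaf.1
      (fun c : SuperChart M.toSuperSpace p q => c.dom) fun c => c.coordIso.symm (F c) := by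
    intro c c'
    apply (c.iso (c.dom ⊓ c'.dom) fun _ hx => hx.1).injective
    have h := c.iso_res c.dom (c.dom ⊓ c'.dom) subset_rfl (fun _ hx => hx.1) inf_le_left
      (c.coordIso.symm (F c))
    have h' := c'.iso_res c'.dom (c.dom ⊓ c'.dom) subset_rfl (fun _ hx => hx.2) inf_le_right
      (c'.coordIso.symm (F c'))
    rw [show c.iso c.dom subset_rfl (c.coordIso.symm (F c)) = F c from
      c.coordIso.apply_symm_apply _] at h
    rw [show c'.iso c'.dom subset_rfl (c'.coordIso.symm (F c')) = F c' from
      c'.coordIso.apply_symm_apply _] at h'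
    refine h.trans ((hF c c').symm.trans ?_)
    change c.iso _ _ ((c'.iso _ _).symm (SuperFun.restrict _ _)) = _
    congr 1
    rw [AlgEquiv.symm_apply_eq]
    exact h'.symm
  obtain ⟨f, hf, -⟩ := M.sheaf.existsUnique_gluing' _ ⊤ (fun _ => homOfLE le_top) le_iSup_dom _
    hcompat
  refine ⟨f, fun c => ?_⟩
  rw [← c.coordIso.apply_symm_apply (F c)]
  exact congrArg c.coordIso (hf c)

end Supermanifold

/-- The action of a vector field on functions of the coordinates of a chart. -/
noncomputable def SuperVectorField.inChart {p q : ℕ} {M : Supermanifold.{u} p q} {d : ZMod 2}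
    (Q : SuperVectorField M d) (c : SuperChart M.toSuperSpace p q) :
    SuperFun (Fin q) c.img →ₗ[ℝ] SuperFun (Fin q) c.img :=
  c.coordIso.toLinearMap ∘ₗ Q.app c.dom ∘ₗ c.coordIso.symm.toLinearMap

namespace SuperVectorField

variable {p q : ℕ} {M : Supermanifold.{u} p q} {d : ZMod 2} (Q : SuperVectorField M d)
  (c : SuperChart M.toSuperSpace p q)

theorem inChart_apply (F : SuperFun (Fin q) c.img) :
    Q.inChart c F = c.coordIso (Q.app c.dom (c.coordIso.symm F)) := rfl

theorem readHom_app (f : M.Fun) : c.readHom (Q.app ⊤ f) = Q.inChart c (c.readHom f) := by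
  change c.coordIso (M.res le_top (Q.app ⊤ f)) =
    c.coordIso (Q.app c.dom (c.coordIso.symm (c.coordIso (M.res le_top f))))
  rw [AlgEquiv.symm_apply_apply, Q.app_res]

theorem isSuperDerivation_inChart : SuperFun.IsSuperDerivation d (Q.inChart c) where
  map_invol F := by
    induction F using SuperFun.homogeneous_induction with
    | add F G hF hG => simp only [map_add, hF, hG, smul_add]
    | hom k F hF =>
      have h : Q.inChart c F ∈ SuperFun.parity (k + d) :=
        c.iso_parity _ _ _ _ (Q.app_parity _ k _ (c.symm_mem_parity hF))
      rw [SuperFun.mem_parity_iff.1 hF, SuperFun.mem_parity_iff.1 h, map_smul, smul_smul,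
        ← paritySign_add, add_left_comm, CharTwo.add_self_eq_zero, add_zero]
  leibniz F G := by
    induction F using SuperFun.homogeneous_induction with
    | add F F' hF hF' => simp only [map_add, add_mul, hF, hF']; abel
    | hom k F hF =>
      rw [inChart_apply, map_mul, Q.leibniz _ k _ (c.symm_mem_parity hF), map_add, map_mul, map_smul,
        map_mul, AlgEquiv.apply_symm_apply, AlgEquiv.apply_symm_apply, SuperFun.sgn_of_mem hF,
        smul_mul_assoc]
      rfl

end SuperVectorField

namespace OddJacobiStructure

open CotFun IsLocalOddJacobi

variable {p q : ℕ} {M : Supermanifold.{u} p q} (J : OddJacobiStructure M)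

theorem isLocalOddJacobi (c : SuperChart M.toSuperSpace p q) :
    IsLocalOddJacobi (J.S.expr c) (J.Q.inChart c) where
  odd := J.odd c
  quadratic := J.quadratic c
  derivation := J.Q.isSuperDerivation_inChart c
  homological F := by
    rw [SuperVectorField.inChart_apply, SuperVectorField.inChart_apply, AlgEquiv.symm_apply_apply,
      J.homological, map_zero]
  invariance := J.invariance c
  compatibility := J.compatibility c

/-- The derived brackets of the coordinate expressions of `S` are the coordinate expressions of a
global function. -/
theorem exists_derivedBracket (f g : M.Fun) :
    ∃ t : M.Fun, ∀ c : SuperChart M.toSuperSpace p q,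
      c.readHom t = derivedBracket (J.S.expr c) (c.readHom f) (c.readHom g) := by
  refine Supermanifold.exists_read_eq _ fun c c' => ?_
  obtain ⟨Φ, hΦ, hS⟩ := J.S.compatible c c'
  rw [(J.quadratic c).restrict_derivedBracket, (J.quadratic c').restrict_derivedBracket,
    hΦ.map_derivedBracket ((J.quadratic c').restrict _)
      (by rw [hS]; exact (J.quadratic c).restrict _), hS, SuperChart.transition_restrict_read,
    SuperChart.transition_restrict_read]

/-- The condition defining the odd Jacobi bracket, as an identity of functions on the base. -/
theorem isOddJacobiBracket_iff (B : M.Fun →ₗ[ℝ] M.Fun →ₗ[ℝ] M.Fun) :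
    IsOddJacobiBracket J B ↔ ∀ i j : ZMod 2, ∀ f ∈ M.parity ⊤ i, ∀ g ∈ M.parity ⊤ j,
      ∀ c : SuperChart M.toSuperSpace p q, c.readHom (B f g) = paritySign (i + 1) •
        symmetricBracket (J.S.expr c) (J.Q.inChart c) (c.readHom f) (c.readHom g) := by
  refine forall₂_congr fun i j => forall₂_congr fun f _ => forall₂_congr fun g _ =>
    forall_congr' fun c => ?_
  have h : paritySign (i + 1) • poisson (poisson (J.S.expr c) (pullback (c.readHom f)))
        (pullback (c.readHom g)) -
      paritySign (i + 1) • poisson (J.Q.symbol c) (pullback (c.readHom (f * g))) =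
      pullback (paritySign (i + 1) •
        symmetricBracket (J.S.expr c) (J.Q.inChart c) (c.readHom f) (c.readHom g)) := by
    have hq := poisson_symbol_pullback (J.Q.isSuperDerivation_inChart c) (c.readHom (f * g))
    rw [← (J.quadratic c).pullback_derivedBracket, map_smul, symmetricBracket_apply, map_sub,
      smul_sub, ← map_mul]
    exact congrArg _ (congrArg _ hq)
  rw [SuperChart.read_eq, SuperChart.read_eq, SuperChart.read_eq, SuperChart.read_eq,
    paritySign_def, h]
  exact pullback_injective.eq_iff

theorem exists_bilinear_derivedBracket :
    ∃ T : M.Fun →ₗ[ℝ] M.Fun →ₗ[ℝ] M.Fun, ∀ f g, ∀ c : SuperChart M.toSuperSpace p q,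
      c.readHom (T f g) = derivedBracket (J.S.expr c) (c.readHom f) (c.readHom g) := by
  choose t ht using J.exists_derivedBracket
  exact ⟨LinearMap.mk₂ ℝ t
    (fun f f' g => Supermanifold.ext_read fun c => by
      simp only [map_add, LinearMap.add_apply, ht])
    (fun r f g => Supermanifold.ext_read fun c => by
      simp only [map_smul, LinearMap.smul_apply, ht])
    (fun f g g' => Supermanifold.ext_read fun c => by simp only [map_add, ht])
    (fun r f g => Supermanifold.ext_read fun c => by simp only [map_smul, ht]), ht⟩

theorem exists_isOddJacobiBracket : ∃ B, IsOddJacobiBracket J B := by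
  obtain ⟨T, hT⟩ := J.exists_bilinear_derivedBracket
  -- precomposition with `-f ↦ -(-1)^{f̃} f` realizes the sign `(-1)^{f̃ + 1}` linearly
  refine ⟨-((T - (LinearMap.mul ℝ M.Fun).compr₂ (J.Q.app ⊤)) ∘ₗ M.invol ⊤),
    (J.isOddJacobiBracket_iff _).2 fun i j f hf g _ c => ?_⟩
  have h : (-((T - (LinearMap.mul ℝ M.Fun).compr₂ (J.Q.app ⊤)) ∘ₗ M.invol ⊤)) f g =
      paritySign (i + 1) • (T f g - J.Q.app ⊤ (f * g)) := by
    simp only [LinearMap.neg_apply, LinearMap.comp_apply, SuperSpace.invol_of_mem hf,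
      map_smul, LinearMap.smul_apply, paritySign_add, paritySign_one, mul_neg, mul_one, neg_smul]
    rfl
  rw [h, map_smul, map_sub, hT, J.Q.readHom_app, map_mul]
  rfl

theorem eq_of_isOddJacobiBracket {B B' : M.Fun →ₗ[ℝ] M.Fun →ₗ[ℝ] M.Fun}
    (hB : IsOddJacobiBracket J B) (hB' : IsOddJacobiBracket J B') : B = B' := by
  rw [isOddJacobiBracket_iff] at hB hB'
  refine LinearMap.ext₂ fun f g => ?_
  induction f using SuperSpace.homogeneous_induction with
  | add f f' hf hf' => rw [map_add, map_add, LinearMap.add_apply, LinearMap.add_apply, hf, hf']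
  | hom i f hf =>
  induction g using SuperSpace.homogeneous_induction with
  | add g g' hg hg' => rw [map_add, map_add, hg, hg']
  | hom j g hg =>
    exact Supermanifold.ext_read fun c => by rw [hB i j f hf g hg, hB' i j f hf g hg]

theorem isOddJacobiAlgebra {B : M.Fun →ₗ[ℝ] M.Fun →ₗ[ℝ] M.Fun} (hB : IsOddJacobiBracket J B) :
    IsOddJacobiAlgebra (M.parity ⊤) B := by
  rw [isOddJacobiBracket_iff] at hB
  have hgr : ∀ i j, ∀ f ∈ M.parity ⊤ i, ∀ g ∈ M.parity ⊤ j, B f g ∈ M.parity ⊤ (i + j + 1) := by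
    intro i j f hf g hg
    refine Supermanifold.mem_parity_iff.2 fun c => ?_
    rw [hB i j f hf g hg]
    exact Submodule.smul_mem _ _ ((J.isLocalOddJacobi c).symmetricBracket_mem
      (c.readHom_mem_parity hf) (c.readHom_mem_parity hg))
  have hone : (1 : M.Fun) ∈ M.parity ⊤ 0 := (M.graded ⊤).one_mem
  refine ⟨hgr, fun i j f hf g hg => ?_, fun i j k f hf g hg h hh => ?_,
    fun i j k f hf g hg h hh => ?_⟩ <;>
  refine Supermanifold.ext_read fun c => ?_ <;>
  have H := J.isLocalOddJacobi c <;>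
  have hf' := c.readHom_mem_parity hf <;>
  have hg' := c.readHom_mem_parity hg <;>
  simp only [paritySign_def, map_neg, map_smul, map_add, map_sub, map_mul, map_zero]
  · rw [hB i j f hf g hg, hB j i g hg f hf, H.symmetricBracket_symm hf' hg']
    rcases ZMod.eq_zero_or_eq_one_of_two i with rfl | rfl <;>
    rcases ZMod.eq_zero_or_eq_one_of_two j with rfl | rfl <;>
    simp only [paritySign_zero, paritySign_one, mul_zero, mul_one, zero_add,
      ZMod.one_add_one_of_two] <;> module
  · have hh' := c.readHom_mem_parity hh
    rw [hB _ _ f hf _ (hgr _ _ g hg h hh), hB _ _ g hg _ (hgr _ _ h hh f hf),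
      hB _ _ h hh _ (hgr _ _ f hf g hg), hB _ _ f hf g hg, hB _ _ g hg h hh, hB _ _ h hh f hf]
    simp only [map_smul]
    rw [H.symmetricBracket_symm hf' (H.symmetricBracket_mem hg' hh'),
      H.symmetricBracket_symm hg' (H.symmetricBracket_mem hh' hf'),
      H.symmetricBracket_symm hh' (H.symmetricBracket_mem hf' hg')]
    have hJ := H.symmetricBracket_jacobi hf' hg' hh'
    linear_combination (norm := skip) paritySign (i + j + k + 1) • hJ
    rcases ZMod.eq_zero_or_eq_one_of_two i with rfl | rfl <;>
    rcases ZMod.eq_zero_or_eq_one_of_two j with rfl | rfl <;>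
    rcases ZMod.eq_zero_or_eq_one_of_two k with rfl | rfl <;>
    simp only [paritySign_zero, paritySign_one, mul_zero, mul_one, zero_add,
      add_zero, ZMod.one_add_one_of_two] <;> module
  · rw [hB _ _ f hf _ ((M.graded ⊤).mul_mem hg hh), hB _ _ f hf g hg, hB _ _ f hf h hh,
      hB _ _ f hf 1 hone, map_mul, map_one c.readHom, H.symmetricBracket_mul hf' hg']
    simp only [smul_sub, smul_add, smul_mul_assoc, mul_smul_comm]
    module

end OddJacobiStructure

theorem mainTheorem1 {p q : ℕ} (M : Supermanifold.{u} p q) (J : OddJacobiStructure M) :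
    (∃! B : M.Fun →ₗ[ℝ] M.Fun →ₗ[ℝ] M.Fun, IsOddJacobiBracket J B) ∧
      ∀ B : M.Fun →ₗ[ℝ] M.Fun →ₗ[ℝ] M.Fun, IsOddJacobiBracket J B →
        IsOddJacobiAlgebra (M.parity ⊤) B :=
  ⟨existsUnique_of_exists_of_unique J.exists_isOddJacobiBracket
    fun _ _ => J.eq_of_isOddJacobiBracket, fun _ => J.isOddJacobiAlgebra⟩
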